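/- Let $T>0$, $n,m_1,m_2\in\mathbb N$, let $A,C,Q_1,Q_2\in L^\infty(0,T;\mathbb R^{n\times n})$, $B_i,D_i\in L^\infty(0,T;\mathbb R^{n\times m_i})$, $R_i\in L^\infty(0,T;\mathbb R^{m_i\times m_i})$ ($i=1,2$) and $G_1,G_2\in\mathbb R^{n\times n}$, with $Q_i,R_i,G_i$ symmetric. Assume the positivity conditions: $Q_1,Q_2,G_1,G_2\ge 0$ and $R_1\ge\delta I$, $R_2\ge\delta I$ for some $\delta>0$ (for a.e. $t$). For symmetric positive semidefinite $P_1,P_2$ put $N=(R_2+D_2^\top P_2D_2)^{-1}$ and $$\mathbf B=B_1-B_2ND_2^\top P_2D_1,\qquad \mathbf D=D_1-D_2ND_2^\top P_2D_1,\qquad \mathbf C_0=C-D_2N(B_2^\top P_2+D_2^\top P_2C),$$ $$\bar\Theta_1=-\big[R_1+\mathbf D^\top P_1\mathbf D\big]^{-1}\big[\mathbf B^\top P_1+\mathbf D^\top P_1\mathbf C_0\big],\qquad \Theta_2^*=-N\big[B_2^\top P_2+D_2^\top P_2(C+D_1\bar\Theta_1)\big],$$ $$\mathbf A=A-B_2N(B_2^\top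 P_2+D_2^\top P_2C)+\mathbf B\bar\Theta_1,\qquad \mathbf C=\mathbf C_0+\mathbf D\bar\Theta_1 .$$ The equilibrium Riccati equation (ERE) is the system $$\dot P_2=-\big[\mathbf A^\top P_2+P_2\mathbf A+\mathbf C^\top P_2\mathbf C+Q_2+(\Theta_2^*)^\top R_2\Theta_2^*\big],\quad \dot P_1=-\big[\mathbf A^\top P_1+P_1\mathbf A+\mathbf C^\top P_1\mathbf C+Q_1+\bar\Theta_1^\top R_1\bar\Theta_1\big],$$ with $P_2(T)=G_2$, $P_1(T)=G_1$. A solution on $[\tau,T]$ is a pair $(P_1,P_2)$ of continuous functions on $[\tau,T]$ with values in the symmetric positive semidefinite matrices that satisfies the system in integrated (Carathéodory) form. Suppose that one of the following holds: (i) $n=m_1=m_2=1$ and, for some constant $\delta>0$, $|D_2(t)|>\delta$ for a.e. $t\in[0,T]$; (ii) $n=m_1=m_2=1$ and $D_2=0$ a.e. on $[0,T]$; (iii) $n,m_1,m_2$ are arbitrary, $D_2=0$ a.e. on $[0,T]$, $\operatorname{rank}B_2(t)=n$ for every $t\in[0,T]$, and $B_2,R_2$ are continuously differentiable on $[0,T]$.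 Then the ERE admits an a priori estimate: there is a constant $\mathcal C_{\mathrm{pri}}$, depending only on the system parameters (the coefficients above and $T$), such that for every $\tau\in[0,T)$ every solution $(P_1,P_2)$ of the ERE on $[\tau,T]$ satisfies $$\sup_{s\in[\tau,T]}\left|\begin{pmatrix}\operatorname{vec}P_1(s)\\ \operatorname{vec}P_2(s)\end{pmatrix}\right|\le\mathcal C_{\mathrm{pri}}.$$ Moreover, the ERE has exactly one solution on $[0,T]$. -/

import Mathlib

open MeasureTheory
open scoped Matrix

noncomputable section

/-- The data of a linear-quadratic Stackelberg game: the coefficients of the state equation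
`dX = (A X + B₁ u + B₂ v) ds + (C X + D₁ u + D₂ v) dW` and the weights of the two quadratic
costs (index 1: leader, index 2: follower). -/
structure LQGame (n m₁ m₂ : ℕ) where
  A : ℝ → Matrix (Fin n) (Fin n) ℝ
  B₁ : ℝ → Matrix (Fin n) (Fin m₁) ℝ
  B₂ : ℝ → Matrix (Fin n) (Fin m₂) ℝ
  C : ℝ → Matrix (Fin n) (Fin n) ℝ
  D₁ : ℝ → Matrix (Fin n) (Fin m₁) ℝ
  D₂ : ℝ → Matrix (Fin n) (Fin m₂) ℝ
  Q₁ : ℝ → Matrix (Fin n) (Fin n) ℝ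
  Q₂ : ℝ → Matrix (Fin n) (Fin n) ℝ
  R₁ : ℝ → Matrix (Fin m₁) (Fin m₁) ℝ
  R₂ : ℝ → Matrix (Fin m₂) (Fin m₂) ℝ
  G₁ : Matrix (Fin n) (Fin n) ℝ
  G₂ : Matrix (Fin n) (Fin n) ℝ

/-- `M ∈ L^∞(0,T; ℝ^{k×l})`: every entry is measurable and essentially bounded on `[0,T]`. -/
def MatrixLInfty {k l : ℕ} (T : ℝ) (M : ℝ → Matrix (Fin k) (Fin l) ℝ) : Prop :=
  ∀ i j, MemLp (fun t => M t i j) ⊤ (volume.restrict (Set.Icc 0 T))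

/-- `M` is continuously differentiable on `[0,T]` (entrywise, one-sidedly at the end points). -/
def MatrixC1 {k l : ℕ} (T : ℝ) (M : ℝ → Matrix (Fin k) (Fin l) ℝ) : Prop :=
  ∀ i j, ContDiffOn ℝ 1 (fun t => M t i j) (Set.Icc 0 T)

namespace LQGame

variable {n m₁ m₂ : ℕ}

/-- All time-dependent coefficients belong to `L^∞` on `(0,T)`. -/
structure BoundedCoefficients (S : LQGame n m₁ m₂) (T : ℝ) : Prop where
  A : MatrixLInfty T S.A
  B₁ : MatrixLInfty T S.B₁
  B₂ : MatrixLInfty T S.B₂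
  C : MatrixLInfty T S.C
  D₁ : MatrixLInfty T S.D₁
  D₂ : MatrixLInfty T S.D₂
  Q₁ : MatrixLInfty T S.Q₁
  Q₂ : MatrixLInfty T S.Q₂
  R₁ : MatrixLInfty T S.R₁
  R₂ : MatrixLInfty T S.R₂

/-- The positivity assumptions `Q₁, Q₂, G₁, G₂ ≥ 0` and `R₁ ≥ δ I`, `R₂ ≥ δ I` for some `δ > 0`
(`Matrix.PosSemidef` includes symmetry). -/
def Positivity (S : LQGame n m₁ m₂) (T : ℝ) : Prop :=
  S.G₁.PosSemidef ∧ S.G₂.PosSemidef ∧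
  (∀ᵐ t ∂(volume.restrict (Set.Icc 0 T)), (S.Q₁ t).PosSemidef ∧ (S.Q₂ t).PosSemidef) ∧
  ∃ δ : ℝ, 0 < δ ∧ ∀ᵐ t ∂(volume.restrict (Set.Icc 0 T)),
    (S.R₁ t - δ • (1 : Matrix (Fin m₁) (Fin m₁) ℝ)).PosSemidef ∧
    (S.R₂ t - δ • (1 : Matrix (Fin m₂) (Fin m₂) ℝ)).PosSemidef

/-- `(R₂ + D₂ᵀ P₂ D₂)⁻¹` at time `t`. -/
def N₂ (S : LQGame n m₁ m₂) (t : ℝ) (P₂ : Matrix (Fin n) (Fin n) ℝ) :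
    Matrix (Fin m₂) (Fin m₂) ℝ :=
  (S.R₂ t + (S.D₂ t)ᵀ * P₂ * S.D₂ t)⁻¹

/-- `𝐁(P₂) = B₁ - B₂ (R₂ + D₂ᵀ P₂ D₂)⁻¹ D₂ᵀ P₂ D₁`. -/
def bB (S : LQGame n m₁ m₂) (t : ℝ) (P₂ : Matrix (Fin n) (Fin n) ℝ) :
    Matrix (Fin n) (Fin m₁) ℝ :=
  S.B₁ t - S.B₂ t * S.N₂ t P₂ * ((S.D₂ t)ᵀ * P₂ * S.D₁ t)

/-- `𝐃(P₂) = D₁ - D₂ (R₂ + D₂ᵀ P₂ D₂)⁻¹ D₂ᵀ P₂ D₁`. -/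
def bD (S : LQGame n m₁ m₂) (t : ℝ) (P₂ : Matrix (Fin n) (Fin n) ℝ) :
    Matrix (Fin n) (Fin m₁) ℝ :=
  S.D₁ t - S.D₂ t * S.N₂ t P₂ * ((S.D₂ t)ᵀ * P₂ * S.D₁ t)

/-- `𝐀(Θ₁, P₂) = A - B₂ (R₂ + D₂ᵀ P₂ D₂)⁻¹ (B₂ᵀ P₂ + D₂ᵀ P₂ C) + 𝐁(P₂) Θ₁`. -/
def bA (S : LQGame n m₁ m₂) (t : ℝ) (Θ₁ : Matrix (Fin m₁) (Fin n) ℝ)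
    (P₂ : Matrix (Fin n) (Fin n) ℝ) : Matrix (Fin n) (Fin n) ℝ :=
  S.A t - S.B₂ t * S.N₂ t P₂ * ((S.B₂ t)ᵀ * P₂ + (S.D₂ t)ᵀ * P₂ * S.C t) + S.bB t P₂ * Θ₁

/-- `𝐂(Θ₁, P₂) = C - D₂ (R₂ + D₂ᵀ P₂ D₂)⁻¹ (B₂ᵀ P₂ + D₂ᵀ P₂ C) + 𝐃(P₂) Θ₁`. -/
def bC (S : LQGame n m₁ m₂) (t : ℝ) (Θ₁ : Matrix (Fin m₁) (Fin n) ℝ)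
    (P₂ : Matrix (Fin n) (Fin n) ℝ) : Matrix (Fin n) (Fin n) ℝ :=
  S.C t - S.D₂ t * S.N₂ t P₂ * ((S.B₂ t)ᵀ * P₂ + (S.D₂ t)ᵀ * P₂ * S.C t) + S.bD t P₂ * Θ₁

/-- The leader's equilibrium feedback `Θ̄₁` as a function of `(P₁, P₂)`. -/
def Θ₁ (S : LQGame n m₁ m₂) (t : ℝ) (P₁ P₂ : Matrix (Fin n) (Fin n) ℝ) :
    Matrix (Fin m₁) (Fin n) ℝ :=
  -((S.R₁ t + (S.bD t P₂)ᵀ * P₁ * S.bD t P₂)⁻¹ *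
    ((S.bB t P₂)ᵀ * P₁ + (S.bD t P₂)ᵀ * P₁ *
      (S.C t - S.D₂ t * S.N₂ t P₂ * ((S.B₂ t)ᵀ * P₂ + (S.D₂ t)ᵀ * P₂ * S.C t))))

/-- The follower's response
`Θ₂*(Θ₁) = -(R₂ + D₂ᵀ P₂ D₂)⁻¹ (B₂ᵀ P₂ + D₂ᵀ P₂ (C + D₁ Θ₁))`. -/
def Θ₂ (S : LQGame n m₁ m₂) (t : ℝ) (Θ₁ : Matrix (Fin m₁) (Fin n) ℝ)
    (P₂ : Matrix (Fin n) (Fin n) ℝ) : Matrix (Fin m₂) (Fin n) ℝ :=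
  -(S.N₂ t P₂ * ((S.B₂ t)ᵀ * P₂ + (S.D₂ t)ᵀ * P₂ * (S.C t + S.D₁ t * Θ₁)))

/-- Minus the right-hand side of the `P₁`-equation of the equilibrium Riccati equation. -/
def F₁ (S : LQGame n m₁ m₂) (t : ℝ) (P₁ P₂ : Matrix (Fin n) (Fin n) ℝ) :
    Matrix (Fin n) (Fin n) ℝ :=
  let θ₁ := S.Θ₁ t P₁ P₂
  (S.bA t θ₁ P₂)ᵀ * P₁ + P₁ * S.bA t θ₁ P₂ + (S.bC t θ₁ P₂)ᵀ * P₁ * S.bC t θ₁ P₂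
    + S.Q₁ t + θ₁ᵀ * S.R₁ t * θ₁

/-- Minus the right-hand side of the `P₂`-equation of the equilibrium Riccati equation. -/
def F₂ (S : LQGame n m₁ m₂) (t : ℝ) (P₁ P₂ : Matrix (Fin n) (Fin n) ℝ) :
    Matrix (Fin n) (Fin n) ℝ :=
  let θ₁ := S.Θ₁ t P₁ P₂
  let θ₂ := S.Θ₂ t θ₁ P₂
  (S.bA t θ₁ P₂)ᵀ * P₂ + P₂ * S.bA t θ₁ P₂ + (S.bC t θ₁ P₂)ᵀ * P₂ * S.bC t θ₁ P₂
    + S.Q₂ t + θ₂ᵀ * S.R₂ t * θ₂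

/-- `(P₁, P₂) ∈ C([τ,T]; 𝕊₊ × 𝕊₊)` solves the equilibrium Riccati equation
`Ṗᵢ = -Fᵢ(t, P₁, P₂)`, `Pᵢ(T) = Gᵢ` on `[τ,T]` in the sense of Carathéodory: `Pᵢ` is the integral
of an integrable function and the equation holds almost everywhere. -/
structure IsERESolution (S : LQGame n m₁ m₂) (τ T : ℝ)
    (P₁ P₂ : ℝ → Matrix (Fin n) (Fin n) ℝ) : Prop where
  continuousOn₁ : ContinuousOn P₁ (Set.Icc τ T)
  continuousOn₂ : ContinuousOn P₂ (Set.Icc τ T)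
  posSemidef₁ : ∀ t ∈ Set.Icc τ T, (P₁ t).PosSemidef
  posSemidef₂ : ∀ t ∈ Set.Icc τ T, (P₂ t).PosSemidef
  integrable₁ : ∀ i j, IntegrableOn (fun s => S.F₁ s (P₁ s) (P₂ s) i j) (Set.Icc τ T)
  integrable₂ : ∀ i j, IntegrableOn (fun s => S.F₂ s (P₁ s) (P₂ s) i j) (Set.Icc τ T)
  eq₁ : ∀ t ∈ Set.Icc τ T, ∀ i j,
    P₁ t i j = S.G₁ i j + ∫ s in t..T, S.F₁ s (P₁ s) (P₂ s) i j
  eq₂ : ∀ t ∈ Set.Icc τ T, ∀ i j,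
    P₂ t i j = S.G₂ i j + ∫ s in t..T, S.F₂ s (P₁ s) (P₂ s) i j

/-- The Euclidean norm of the column `(vec P₁, vec P₂)`. -/
def vecNorm (P₁ P₂ : Matrix (Fin n) (Fin n) ℝ) : ℝ :=
  Real.sqrt ((∑ i, ∑ j, P₁ i j ^ 2) + ∑ i, ∑ j, P₂ i j ^ 2)

/-- A priori estimate: one constant, determined by the data on `[0,T]`, bounds every solution of
the equilibrium Riccati equation on every interval `[τ,T]`, `0 ≤ τ < T` (in particular every
solution on `[0,T]`, for `τ = 0`). -/
def AprioriEstimate (S : LQGame n m₁ m₂) (T : ℝ) : Prop :=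
  ∃ K : ℝ, ∀ τ : ℝ, 0 ≤ τ → τ < T → ∀ P₁ P₂ : ℝ → Matrix (Fin n) (Fin n) ℝ,
    S.IsERESolution τ T P₁ P₂ → ∀ s ∈ Set.Icc τ T, vecNorm (P₁ s) (P₂ s) ≤ K

/-- Global well-posedness: the equilibrium Riccati equation has a unique solution on `[0,T]`. -/
def GloballyWellPosed (S : LQGame n m₁ m₂) (T : ℝ) : Prop :=
  ∃ P₁ P₂ : ℝ → Matrix (Fin n) (Fin n) ℝ, S.IsERESolution 0 T P₁ P₂ ∧
    ∀ P₁' P₂' : ℝ → Matrix (Fin n) (Fin n) ℝ, S.IsERESolution 0 T P₁' P₂' →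
      ∀ s ∈ Set.Icc 0 T, P₁' s = P₁ s ∧ P₂' s = P₂ s

/-- One-dimensional case with follower's diffusion coefficient bounded away from zero. -/
def CaseNondegenerate (S : LQGame n m₁ m₂) (T : ℝ) : Prop :=
  n = 1 ∧ m₁ = 1 ∧ m₂ = 1 ∧
  ∃ δ : ℝ, 0 < δ ∧ ∀ᵐ t ∂(volume.restrict (Set.Icc 0 T)), ∀ i j, δ < |S.D₂ t i j|

/-- One-dimensional case without follower's control in the diffusion. -/
def CaseScalar (S : LQGame n m₁ m₂) (T : ℝ) : Prop :=
  n = 1 ∧ m₁ = 1 ∧ m₂ = 1 ∧ ∀ᵐ t ∂(volume.restrict (Set.Icc 0 T)), S.D₂ t = 0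

/-- Case of arbitrary dimension: no follower's control in the diffusion, `B₂` of full row rank
at every time, and `B₂`, `R₂` continuously differentiable on `[0,T]`. -/
def CaseFullRank (S : LQGame n m₁ m₂) (T : ℝ) : Prop :=
  (∀ᵐ t ∂(volume.restrict (Set.Icc 0 T)), S.D₂ t = 0) ∧
  (∀ t ∈ Set.Icc 0 T, (S.B₂ t).rank = n) ∧ MatrixC1 T S.B₂ ∧ MatrixC1 T S.R₂

end LQGame

end

/-! The a priori estimate carries everything. Completing the square (`complete_square`) turns each
right-hand side into a Lyapunov operator plus a source, minus a positive semidefinite quadratic term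
that upper bounds may discard (`F₁_eq`, `F₂_eq`). For `P₁` the remaining operator has drift `A₀` and
diffusion `C₀`, both depending on `P₂`. Suppose `bB`, `bD`, `C₀` are bounded uniformly in `P₂`, and
a Lipschitz, uniformly positive weight `W` makes the drift part of `tr (W P₁)` at most linear in `tr
P₁`. Then Grönwall (`trace_bound`) bounds `P₁`, hence `Θ₁`. The `P₂`-operator involves only `A + B₁
Θ₁` and `C + D₁ Θ₁`, so Grönwall with weight `1` bounds `P₂` (`aprioriEstimate_of_weight`).

The three cases supply the weight. If `D₂` is scalar and bounded away from zero, the gain `N₂`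
decays like `1 / P₂`, all coefficients are bounded, and `W = 1` works. If `D₂ = 0`, the drift is `A
- M P₂` with `M = B₂ R₂⁻¹ B₂ᵀ`, and the unbounded terms are `-tr (W P₂ M P₁)` and `-tr (W P₁ M P₂)`.
For scalars they are nonpositive with `W = 1`. In general `W = M` makes them traces of products of
positive semidefinite matrices; full rank makes `M` definite and the C¹ assumption makes it
Lipschitz in time.

For well-posedness, the field is bounded and Lipschitz on bounded sets of positive semidefinite
pairs, because the inverted matrices are at least `δ I`. Projecting onto the cone and cutting off at
radius `R` gives a globally Lipschitz field, solvable by `exists_caratheodory`. The solution stays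
in the cone: a Lyapunov operator points into it up to second order (`lyapunov_quasi_positive`,
`posSemidef_of_quasi_positive`). With `R` above the a priori bound and the terminal norm, the
solution never reaches norm `R`, so the truncation is inactive
(`globallyWellPosed_of_aprioriEstimate`). Uniqueness is a Grönwall argument. -/

namespace LQGame

/-! ### Frobenius norm, trace and positive semidefinite matrices -/

section MatrixLemmas

open scoped Matrix.Norms.Frobenius
open Matrix

variable {k l n m : ℕ}

lemma norm_sq_eq_sum (M : Matrix (Fin k) (Fin l) ℝ) : ‖M‖ ^ 2 = ∑ i, ∑ j, M i j ^ 2 := by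
  rw [Matrix.frobenius_norm_def, ← Real.sqrt_eq_rpow, Real.sq_sqrt]
  · simp
  · positivity

lemma abs_entry_le_norm (M : Matrix (Fin k) (Fin l) ℝ) (i : Fin k) (j : Fin l) :
    |M i j| ≤ ‖M‖ := by
  apply abs_le_of_sq_le_sq _ (norm_nonneg _)
  rw [norm_sq_eq_sum]
  calc M i j ^ 2 ≤ ∑ j', M i j' ^ 2 :=
        Finset.single_le_sum (f := fun j' => M i j' ^ 2) (fun _ _ => sq_nonneg _)
          (Finset.mem_univ j)
    _ ≤ _ := Finset.single_le_sum (f := fun i' => ∑ j', M i' j' ^ 2)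
        (fun _ _ => Finset.sum_nonneg fun _ _ => sq_nonneg _) (Finset.mem_univ i)

lemma norm_le_sum_abs (M : Matrix (Fin k) (Fin l) ℝ) : ‖M‖ ≤ ∑ i, ∑ j, |M i j| := by
  conv_lhs => rw [Matrix.matrix_eq_sum_single M]
  refine (norm_sum_le _ _).trans (Finset.sum_le_sum fun i _ => ?_)
  refine (norm_sum_le _ _).trans (Finset.sum_le_sum fun j _ => ?_)
  apply abs_le_of_sq_le_sq' _ (abs_nonneg _) |>.2
  rw [norm_sq_eq_sum, Finset.sum_eq_single i, Finset.sum_eq_single j]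
  · simp
  · intro j' _ h; simp [h.symm]
  · simp
  · intro i' _ h; simp [h.symm]
  · simp

lemma norm_le_of_entries {M : Matrix (Fin k) (Fin l) ℝ} {c : ℝ} (h : ∀ i j, |M i j| ≤ c) :
    ‖M‖ ≤ k * (l * c) := by
  refine (norm_le_sum_abs M).trans ?_
  calc _ ≤ ∑ _i : Fin k, ∑ _j : Fin l, c :=
        Finset.sum_le_sum fun i _ => Finset.sum_le_sum fun j _ => h i j
    _ = _ := by simp

lemma abs_trace_le (M : Matrix (Fin n) (Fin n) ℝ) : |M.trace| ≤ n * ‖M‖ := by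
  rw [Matrix.trace]
  refine (Finset.abs_sum_le_sum_abs _ _).trans ?_
  calc _ ≤ ∑ _i : Fin n, ‖M‖ := Finset.sum_le_sum fun i _ => abs_entry_le_norm M i i
    _ = _ := by simp

lemma trace_le (M : Matrix (Fin n) (Fin n) ℝ) : M.trace ≤ n * ‖M‖ :=
  (le_abs_self _).trans (abs_trace_le M)

lemma vecNorm_le (P₁ P₂ : Matrix (Fin n) (Fin n) ℝ) : vecNorm P₁ P₂ ≤ ‖P₁‖ + ‖P₂‖ := by
  rw [vecNorm, ← norm_sq_eq_sum, ← norm_sq_eq_sum]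
  apply Real.sqrt_le_iff.2 ⟨by positivity, ?_⟩
  nlinarith [norm_nonneg P₁, norm_nonneg P₂]

lemma norm_prod_le_vecNorm (P₁ P₂ : Matrix (Fin n) (Fin n) ℝ) : ‖(P₁, P₂)‖ ≤ vecNorm P₁ P₂ := by
  rw [vecNorm, ← norm_sq_eq_sum, ← norm_sq_eq_sum, Prod.norm_def]
  apply max_le
  · exact Real.le_sqrt_of_sq_le (by simp)
  · exact Real.le_sqrt_of_sq_le (by simp)

lemma psd_iff {M : Matrix (Fin n) (Fin n) ℝ} :
    M.PosSemidef ↔ Mᵀ = M ∧ ∀ v : Fin n → ℝ, 0 ≤ v ⬝ᵥ (M *ᵥ v) := by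
  rw [Matrix.posSemidef_iff_dotProduct_mulVec, Matrix.IsHermitian,
    Matrix.conjTranspose_eq_transpose_of_trivial]
  simp

lemma PSD.transpose_eq {M : Matrix (Fin n) (Fin n) ℝ} (h : M.PosSemidef) : Mᵀ = M :=
  (psd_iff.1 h).1

lemma PSD.conj {M : Matrix (Fin n) (Fin n) ℝ} (h : M.PosSemidef) (B : Matrix (Fin n) (Fin m) ℝ) :
    (Bᵀ * M * B).PosSemidef := by
  simpa [Matrix.conjTranspose_eq_transpose_of_trivial] using h.conjTranspose_mul_mul_same B

/-- A decomposition of `M` into rank-one matrices `a aᵀ` reduces the trace to a sum of values `aᵀ N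
a`. -/
lemma PSD.trace_mul_nonneg {M N : Matrix (Fin n) (Fin n) ℝ} (hM : M.PosSemidef)
    (hN : N.PosSemidef) : 0 ≤ (M * N).trace := by
  obtain ⟨k, A, rfl⟩ := Matrix.posSemidef_iff_eq_sum_vecMulVec.1 hM
  rw [Finset.sum_mul, Matrix.trace_sum]
  refine Finset.sum_nonneg fun i _ => ?_
  rw [Matrix.vecMulVec_mul, Matrix.trace_vecMulVec, dotProduct_comm, ← Matrix.dotProduct_mulVec]
  exact hN.dotProduct_mulVec_nonneg (A i)

/-- Testing the quadratic form on `eᵢ ± eⱼ` gives `2 |M i j| ≤ M i i + M j j`. This is what lets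
trace bounds control norms throughout. -/
lemma PSD.abs_entry_le_trace {M : Matrix (Fin n) (Fin n) ℝ} (hM : M.PosSemidef) (i j : Fin n) :
    |M i j| ≤ M.trace := by
  have hs := (psd_iff.1 hM).1
  have hd : ∀ i, 0 ≤ M i i := fun i => hM.diag_nonneg
  have hij : M j i = M i j := by exact congrFun (congrFun hs i) j
  have hp := (psd_iff.1 hM).2 (Pi.single i 1 + Pi.single j 1)
  have hq := (psd_iff.1 hM).2 (Pi.single i 1 - Pi.single j 1)
  simp [Matrix.mulVec_add, Matrix.mulVec_sub, add_dotProduct, sub_dotProduct] at hp hq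
  have htr : M i i ≤ M.trace ∧ M j j ≤ M.trace :=
    ⟨Finset.single_le_sum (f := fun i => M i i) (fun i _ => hd i) (Finset.mem_univ i),
      Finset.single_le_sum (f := fun i => M i i) (fun i _ => hd i) (Finset.mem_univ j)⟩
  rw [abs_le]
  constructor <;> linarith

lemma PSD.norm_le_trace {M : Matrix (Fin n) (Fin n) ℝ} (hM : M.PosSemidef) :
    ‖M‖ ≤ n * (n * M.trace) :=
  norm_le_of_entries fun i j => PSD.abs_entry_le_trace hM i j

lemma dotProduct_mulVec_abs_le (M : Matrix (Fin n) (Fin n) ℝ) (v : Fin n → ℝ) :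
    |v ⬝ᵥ (M *ᵥ v)| ≤ n * ‖M‖ * (v ⬝ᵥ v) := by
  have h1 : v ⬝ᵥ (M *ᵥ v) = ∑ i, ∑ j, v i * M i j * v j := by
    simp [dotProduct, Matrix.mulVec, Finset.mul_sum, mul_assoc]
  rw [h1]
  calc _ ≤ ∑ i, ∑ j, |v i * M i j * v j| :=
        (Finset.abs_sum_le_sum_abs _ _).trans
          (Finset.sum_le_sum fun i _ => Finset.abs_sum_le_sum_abs _ _)
    _ ≤ ∑ i, ∑ j, ‖M‖ * ((v i * v i + v j * v j) / 2) := by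
        refine Finset.sum_le_sum fun i _ => Finset.sum_le_sum fun j _ => ?_
        have h2 := abs_entry_le_norm M i j
        have h3 : |v i| * |v j| ≤ (v i * v i + v j * v j) / 2 := by
          nlinarith [sq_nonneg (|v i| - |v j|), abs_mul_abs_self (v i), abs_mul_abs_self (v j)]
        rw [abs_mul, abs_mul]
        calc |v i| * |M i j| * |v j| = |M i j| * (|v i| * |v j|) := by ring
          _ ≤ _ := mul_le_mul h2 h3 (by positivity) (norm_nonneg _)
    _ = n * ‖M‖ * (v ⬝ᵥ v) := by
        simp only [dotProduct, ← Finset.mul_sum, add_div, Finset.sum_add_distrib,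
          Finset.sum_const, Finset.card_univ, Fintype.card_fin, nsmul_eq_mul, ← Finset.sum_div]
        ring

lemma psd_smul_one_add {M : Matrix (Fin n) (Fin n) ℝ} (hs : Mᵀ = M) {c : ℝ} (hc : n * ‖M‖ ≤ c) :
    (M + c • (1 : Matrix (Fin n) (Fin n) ℝ)).PosSemidef := by
  refine psd_iff.2 ⟨by simp [hs], fun v => ?_⟩
  have h1 := (abs_le.1 (dotProduct_mulVec_abs_le M v)).1
  have h2 : 0 ≤ v ⬝ᵥ v := Finset.sum_nonneg fun i _ => mul_self_nonneg (v i)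
  simp only [Matrix.add_mulVec, Matrix.smul_mulVec, Matrix.one_mulVec, dotProduct_add,
    dotProduct_smul, smul_eq_mul]
  nlinarith

lemma dotProduct_le_of_coercive {M : Matrix (Fin n) (Fin n) ℝ} {δ : ℝ}
    (h : (M - δ • (1 : Matrix (Fin n) (Fin n) ℝ)).PosSemidef) (v : Fin n → ℝ) :
    δ * (v ⬝ᵥ v) ≤ v ⬝ᵥ (M *ᵥ v) := by
  have := (psd_iff.1 h).2 v
  simp only [Matrix.sub_mulVec, Matrix.smul_mulVec, Matrix.one_mulVec, dotProduct_sub,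
    dotProduct_smul, smul_eq_mul] at this
  linarith

lemma transpose_eq_of_coercive {M : Matrix (Fin n) (Fin n) ℝ} {δ : ℝ}
    (h : (M - δ • (1 : Matrix (Fin n) (Fin n) ℝ)).PosSemidef) : Mᵀ = M := by
  have := (psd_iff.1 h).1
  simpa using this

lemma posDef_of_coercive {M : Matrix (Fin n) (Fin n) ℝ} {δ : ℝ} (hδ : 0 < δ)
    (h : (M - δ • (1 : Matrix (Fin n) (Fin n) ℝ)).PosSemidef) : M.PosDef := by
  have := Matrix.PosDef.posSemidef_add h
    ((Matrix.PosDef.one (n := Fin n) (R := ℝ)).smul hδ)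
  simpa using this

/-- A column `x` of the inverse solves `M x = eⱼ`, so coercivity reads `δ |x|² ≤ x j`. This first
forces `x j ≤ δ⁻¹`, and then every entry is at most `δ⁻¹` in absolute value. -/
lemma norm_inv_le_of_coercive {M : Matrix (Fin n) (Fin n) ℝ} {δ : ℝ} (hδ : 0 < δ)
    (h : (M - δ • (1 : Matrix (Fin n) (Fin n) ℝ)).PosSemidef) : ‖M⁻¹‖ ≤ n * (n * δ⁻¹) := by
  refine norm_le_of_entries fun i j => ?_
  have hu := (posDef_of_coercive hδ h).isUnit
  have hdet : IsUnit M.det := (Matrix.isUnit_iff_isUnit_det M).1 hu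
  set x := M⁻¹ *ᵥ Pi.single j 1 with hx
  have hMx : M *ᵥ x = Pi.single j 1 := by
    rw [hx, Matrix.mulVec_mulVec, Matrix.mul_nonsing_inv M hdet, Matrix.one_mulVec]
  have h1 := dotProduct_le_of_coercive h x
  rw [hMx] at h1
  have h2 : x ⬝ᵥ Pi.single j 1 = x j := by simp
  rw [h2] at h1
  have hsq : ∀ i, x i * x i ≤ x ⬝ᵥ x := fun i =>
    Finset.single_le_sum (f := fun i => x i * x i) (fun i _ => mul_self_nonneg (x i))
      (Finset.mem_univ i)
  have hj : x j ≤ δ⁻¹ := by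
    by_contra hcon
    have hcon := not_le.1 hcon
    have h3 : 1 < δ * x j := by
      have := (inv_lt_iff_one_lt_mul₀' hδ).1 hcon
      exact this
    have h0 : 0 < x j := (inv_pos.2 hδ).trans hcon
    nlinarith [hsq j]
  have hxi : x i = M⁻¹ i j := by simp [hx]
  rw [← hxi]
  apply abs_le_of_sq_le_sq _ (inv_nonneg.2 hδ.le)
  have : δ * (x i * x i) ≤ δ⁻¹ := by nlinarith [hsq i]
  have h4 : x i * x i ≤ δ⁻¹ * δ⁻¹ := by
    rw [← div_eq_inv_mul, le_div_iff₀ hδ]; linarith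
  nlinarith

/-! ### The metric projection onto the cone of positive semidefinite matrices -/

/-- Matrices with the Frobenius norm as a Euclidean space. -/
noncomputable def toEuc (n : ℕ) :
    Matrix (Fin n) (Fin n) ℝ →ₗ[ℝ] EuclideanSpace ℝ (Fin n × Fin n) where
  toFun M := WithLp.toLp 2 fun p => M p.1 p.2
  map_add' _ _ := rfl
  map_smul' _ _ := rfl

/-- The inverse of `toEuc`. -/
noncomputable def ofEuc (n : ℕ) (x : EuclideanSpace ℝ (Fin n × Fin n)) : Matrix (Fin n) (Fin n) ℝ :=
  fun i j => x (i, j)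

lemma norm_toEuc (M : Matrix (Fin n) (Fin n) ℝ) : ‖toEuc n M‖ = ‖M‖ := by
  rw [← sq_eq_sq₀ (norm_nonneg _) (norm_nonneg _), norm_sq_eq_sum, EuclideanSpace.norm_sq_eq,
    Fintype.sum_prod_type]
  simp only [Real.norm_eq_abs, sq_abs]
  rfl

lemma isClosed_psd (n : ℕ) : IsClosed {M : Matrix (Fin n) (Fin n) ℝ | M.PosSemidef} := by
  simp only [psd_iff, Set.ofPred_and, Set.ofPred_forall]
  refine IsClosed.inter (isClosed_eq (by fun_prop) continuous_id) (isClosed_iInter fun v => ?_)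
  exact isClosed_le continuous_const (by fun_prop)

/-- The positive semidefinite matrices inside the Euclidean space of matrices. -/
noncomputable def psdEuc (n : ℕ) : Set (EuclideanSpace ℝ (Fin n × Fin n)) :=
  {x | (ofEuc n x).PosSemidef}

lemma psdEuc_isClosed (n : ℕ) : IsClosed (psdEuc n) := by
  refine (isClosed_psd n).preimage ?_
  refine continuous_pi fun i => continuous_pi fun j => ?_
  unfold ofEuc
  fun_prop

lemma psdEuc_convex (n : ℕ) : Convex ℝ (psdEuc n) := by
  intro x hx y hy a b ha hb _
  have := (Matrix.PosSemidef.smul hx ha).add (Matrix.PosSemidef.smul hy hb)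
  exact this

lemma exists_psd_projection (x : EuclideanSpace ℝ (Fin n × Fin n)) :
    ∃ v ∈ psdEuc n, ‖x - v‖ = ⨅ w : psdEuc n, ‖x - w‖ :=
  exists_norm_eq_iInf_of_complete_convex ⟨0, show (ofEuc n 0).PosSemidef from
    Matrix.PosSemidef.zero⟩ (psdEuc_isClosed n).isComplete (psdEuc_convex n) x

/-- The metric projection of a matrix onto the cone of positive semidefinite matrices. -/
noncomputable def psdProj (M : Matrix (Fin n) (Fin n) ℝ) : Matrix (Fin n) (Fin n) ℝ :=
  ofEuc n (exists_psd_projection (toEuc n M)).choose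

lemma psdProj_posSemidef (M : Matrix (Fin n) (Fin n) ℝ) : (psdProj M).PosSemidef :=
  (exists_psd_projection (toEuc n M)).choose_spec.1

/-- This is the variational inequality characterizing the nearest point of a closed convex set. -/
lemma inner_psdProj_le (M : Matrix (Fin n) (Fin n) ℝ) {N : Matrix (Fin n) (Fin n) ℝ}
    (hN : N.PosSemidef) :
    inner ℝ (toEuc n M - toEuc n (psdProj M)) (toEuc n N - toEuc n (psdProj M)) ≤ 0 := by
  have hs := (exists_psd_projection (toEuc n M)).choose_spec
  exact (norm_eq_iInf_iff_real_inner_le_zero (psdEuc_convex n) hs.1).1 hs.2 (toEuc n N) hN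

lemma norm_sub_psdProj_le (M : Matrix (Fin n) (Fin n) ℝ) {N : Matrix (Fin n) (Fin n) ℝ}
    (hN : N.PosSemidef) : ‖M - psdProj M‖ ≤ ‖M - N‖ := by
  have h := inner_psdProj_le M hN
  rw [← norm_toEuc, ← norm_toEuc (M - N), map_sub, map_sub]
  set x := toEuc n M
  set p := toEuc n (psdProj M)
  set y := toEuc n N
  have h1 : ‖x - y‖ ^ 2 = ‖x - p‖ ^ 2 - 2 * inner ℝ (x - p) (y - p) + ‖y - p‖ ^ 2 := by
    rw [← norm_sub_sq_real]; congr 2; abel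
  refine abs_le_of_sq_le_sq' ?_ (norm_nonneg _) |>.2
  nlinarith [sq_nonneg ‖y - p‖]

lemma psdProj_eq_self {M : Matrix (Fin n) (Fin n) ℝ} (hM : M.PosSemidef) : psdProj M = M := by
  have := norm_sub_psdProj_le M hM
  rw [sub_self, norm_zero] at this
  exact (sub_eq_zero.1 (norm_le_zero_iff.1 this)).symm

/-- Adding the variational inequalities of the two projections, each tested at the other, and
applying Cauchy–Schwarz shows that the projection is nonexpansive. -/
lemma norm_psdProj_sub_le (M N : Matrix (Fin n) (Fin n) ℝ) :
    ‖psdProj M - psdProj N‖ ≤ ‖M - N‖ := by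
  have h1 := inner_psdProj_le M (psdProj_posSemidef N)
  have h2 := inner_psdProj_le N (psdProj_posSemidef M)
  rw [← norm_toEuc, ← norm_toEuc (M - N), map_sub, map_sub]
  set x := toEuc n M
  set p := toEuc n (psdProj M)
  set y := toEuc n N
  set q := toEuc n (psdProj N)
  have h3 : inner ℝ (p - q) (p - q) ≤ inner ℝ (x - y) (p - q) := by
    simp only [inner_sub_left, inner_sub_right] at h1 h2 ⊢
    linarith [real_inner_comm p q, real_inner_comm x p, real_inner_comm y q]
  rw [real_inner_self_eq_norm_sq] at h3
  have h4 := h3.trans (real_inner_le_norm (x - y) (p - q))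
  by_contra hcon
  nlinarith [norm_nonneg (x - y), norm_nonneg (p - q), not_le.1 hcon]

lemma continuous_psdProj : Continuous (psdProj (n := n)) :=
  (LipschitzWith.of_dist_le_mul (K := 1) fun x y => by
    simpa [dist_eq_norm] using norm_psdProj_sub_le x y).continuous

end MatrixLemmas

/-! ### Carathéodory existence by a weighted contraction -/

section Caratheodory

variable {E : Type*} [NormedAddCommGroup E] [NormedSpace ℝ E] [CompleteSpace E]

/-- Carathéodory's existence theorem for the terminal value problem `x' = -f(t, x)`, `x(T) = g`
with a bounded field that is Lipschitz in `x` and measurable along continuous curves. -/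
theorem exists_caratheodory {T : ℝ} (hT : 0 ≤ T) (f : ℝ → E → E) (g : E) {M L : ℝ} (hL : 0 ≤ L)
    (hmeas : ∀ x : ℝ → E, Continuous x →
      AEStronglyMeasurable (fun s => f s (x s)) (volume.restrict (Set.Icc 0 T)))
    (hbd : ∀ᵐ s ∂(volume.restrict (Set.Icc 0 T)), ∀ x, ‖f s x‖ ≤ M)
    (hlip : ∀ᵐ s ∂(volume.restrict (Set.Icc 0 T)), ∀ x y, ‖f s x - f s y‖ ≤ L * ‖x - y‖) :
    ∃ x : ℝ → E, Continuous x ∧ (IntegrableOn (fun s => f s (x s)) (Set.Icc 0 T)) ∧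
      ∀ t ∈ Set.Icc 0 T, x t = g + ∫ s in t..T, f s (x s) := by
  have hint : ∀ x : ℝ → E, Continuous x → IntegrableOn (fun s => f s (x s)) (Set.Icc 0 T) :=
    fun x hx => Integrable.of_bound (hmeas x hx) M (hbd.mono fun s hs => hs (x s))
  -- With the weight `w t = exp (r (T - t))`, the integral of `w` over `[t, T]` is `(w t - 1) / r`,
  -- so the integral operator contracts by `L / r ≤ 1 / 2` on the whole interval. The `+ 1` keeps
  -- `r` positive when `L = 0`.
  set r : ℝ := 2 * L + 1 with hr
  have hr0 : 0 < r := by positivity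
  set w : ℝ → ℝ := fun t => Real.exp (r * (T - t)) with hw
  have hwc : Continuous w := by fun_prop
  have hwpos : ∀ t, 0 < w t := fun t => Real.exp_pos _
  let ext : C(Set.Icc 0 T, E) → ℝ → E := fun y s => w s • y (Set.projIcc 0 T hT s)
  have hext : ∀ y, Continuous (ext y) := fun y =>
    hwc.smul (y.continuous.comp continuous_projIcc)
  have hprim : ∀ y, ContinuousOn (fun t => ∫ s in t..T, f s (ext y s)) (Set.Icc 0 T) := by
    intro y
    have := intervalIntegral.continuousOn_primitive_interval_left (a := (0 : ℝ)) (b := T)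
      (μ := volume) (f := fun s => f s (ext y s)) (by
        rw [Set.uIcc_of_le hT]; exact hint _ (hext y))
    rwa [Set.uIcc_of_le hT] at this
  -- The unknown is `y = x / w`, so that the plain sup norm of `y` is the weighted norm of `x`.
  let Φ : C(Set.Icc 0 T, E) → C(Set.Icc 0 T, E) := fun y =>
    ⟨fun t => (w t)⁻¹ • (g + ∫ s in (t : ℝ)..T, f s (ext y s)), by
      refine Continuous.smul ?_ (continuous_const.add ?_)
      · exact (hwc.comp continuous_subtype_val).inv₀ fun t => (hwpos t).ne'
      · exact continuousOn_iff_continuous_domRestrict.1 (hprim y)⟩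
  have hsub : ∀ t ∈ Set.Icc 0 T, Set.Ioc t T ⊆ Set.Icc 0 T := fun t ht s hs =>
    ⟨ht.1.trans hs.1.le, hs.2⟩
  have hII : ∀ y, ∀ t ∈ Set.Icc 0 T,
      IntervalIntegrable (fun s => f s (ext y s)) volume t T := fun y t ht =>
    (intervalIntegrable_iff_integrableOn_Ioc_of_le ht.2).2 ((hint _ (hext y)).mono_set (hsub t ht))
  have hwint : ∀ t, ∫ s in t..T, w s = (w t - 1) / r := by
    intro t
    have hd : ∀ s ∈ Set.uIcc t T, HasDerivAt (fun s => -(w s) / r) (w s) s := by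
      intro s _
      have h1 : HasDerivAt (fun s => r * (T - s)) (-r) s := by
        simpa using ((hasDerivAt_id s).const_sub T).const_mul r
      have h2 := (h1.exp.neg).div_const r
      have h3 : -(Real.exp (r * (T - s)) * -r) / r = w s := by
        rw [mul_neg, neg_neg, mul_div_assoc, div_self hr0.ne', mul_one]
      rw [h3] at h2
      exact h2
    rw [intervalIntegral.integral_eq_sub_of_hasDerivAt hd (hwc.intervalIntegrable _ _)]
    simp [hw]
    ring
  have hlipΦ : LipschitzWith (1 / 2) Φ := by
    refine LipschitzWith.of_dist_le_mul fun y z => ?_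
    rw [ContinuousMap.dist_le (by positivity)]
    rintro ⟨t, ht⟩
    have hD : ∀ s, ‖ext y s - ext z s‖ ≤ w s * dist y z := by
      intro s
      simp only [ext]
      rw [← smul_sub, norm_smul, Real.norm_of_nonneg (hwpos s).le, ← dist_eq_norm]
      exact mul_le_mul_of_nonneg_left (ContinuousMap.dist_apply_le_dist _) (hwpos s).le
    have hle : ‖∫ s in t..T, (f s (ext y s) - f s (ext z s))‖ ≤
        ∫ s in t..T, L * dist y z * w s := by
      refine intervalIntegral.norm_integral_le_of_norm_le ht.2 ?_
        ((hwc.const_mul _).intervalIntegrable _ _)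
      have := ae_restrict_of_ae_restrict_of_subset (hsub t ht) hlip
      rw [ae_restrict_iff' measurableSet_Ioc] at this
      filter_upwards [this] with s hs hst
      calc _ ≤ L * ‖ext y s - ext z s‖ := hs hst _ _
        _ ≤ L * (w s * dist y z) := mul_le_mul_of_nonneg_left (hD s) hL
        _ = _ := by ring
    rw [intervalIntegral.integral_const_mul, hwint,
      intervalIntegral.integral_sub (hII y t ht) (hII z t ht)] at hle
    change dist ((w t)⁻¹ • (g + ∫ s in t..T, f s (ext y s)))
      ((w t)⁻¹ • (g + ∫ s in t..T, f s (ext z s))) ≤ _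
    rw [dist_eq_norm, ← smul_sub, add_sub_add_left_eq_sub, norm_smul, norm_inv,
      Real.norm_of_nonneg (hwpos t).le, inv_mul_le_iff₀ (hwpos t)]
    refine hle.trans ?_
    have h3 : L / r ≤ 1 / 2 := by rw [div_le_div_iff₀ hr0 two_pos]; linarith
    have h4 : L / r * (w t - 1) ≤ 1 / 2 * w t := by
      have : 0 ≤ L / r := by positivity
      nlinarith [hwpos t]
    calc L * dist y z * ((w t - 1) / r) = (L / r * (w t - 1)) * dist y z := by ring
      _ ≤ (1 / 2 * w t) * dist y z := mul_le_mul_of_nonneg_right h4 dist_nonneg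
      _ = _ := by push_cast; ring
  have hcontr : ContractingWith (1 / 2) Φ := ⟨by
    rw [← NNReal.coe_lt_coe]; norm_num, hlipΦ⟩
  have : Nonempty C(Set.Icc 0 T, E) := ⟨0⟩
  set y := hcontr.fixedPoint with hy
  have hfix : Φ y = y := hcontr.fixedPoint_isFixedPt
  refine ⟨ext y, hext y, hint _ (hext y), fun t ht => ?_⟩
  have h5 : (w t)⁻¹ • (g + ∫ s in t..T, f s (ext y s)) = y ⟨t, ht⟩ :=
    congrArg (fun z : C(Set.Icc 0 T, E) => z ⟨t, ht⟩) hfix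
  change w t • y (Set.projIcc 0 T hT t) = _
  rw [Set.projIcc_of_mem hT ht, ← h5, smul_inv_smul₀ (hwpos t).ne']

end Caratheodory

/-! ### Backward Grönwall inequality -/

section Gronwall

/-- A discrete form of Grönwall's inequality, backward in time. -/
lemma backward_gronwall {φ : ℝ → ℝ} {τ T c b e : ℝ} (hφ : ContinuousOn φ (Set.Icc τ T))
    (h : ∀ s t, τ ≤ s → s ≤ t → t ≤ T →
      φ s ≤ φ t + (t - s) * (c * φ t + b) + e * (t - s) ^ 2) :
    ∀ s ∈ Set.Icc τ T, φ s ≤ gronwallBound (φ T) c b (T - s) := by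
  intro s hs
  -- Time is reversed by `u ↦ φ (T - u)`. The quadratic error drops out of the limit of the
  -- difference quotients, so `e` does not enter the bound.
  have key := le_gronwallBound_of_liminf_deriv_right_le (f := fun u => φ (T - u))
    (f' := fun u => c * φ (T - u) + b) (δ := φ T) (K := c) (ε := b) (a := 0) (b := T - τ)
    (hφ.comp (by fun_prop) fun u hu => ⟨by linarith [hu.2], by linarith [hu.1]⟩) ?_ (by simp)
    (fun _ _ => le_rfl) (T - s) ⟨by linarith [hs.2], by linarith [hs.1]⟩
  · simpa using key
  · intro u hu r hr
    apply Filter.Eventually.frequently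
    have hlim : Filter.Tendsto (fun z => c * φ (T - u) + b + e * (z - u)) (nhdsWithin u (Set.Ioi u))
        (nhds (c * φ (T - u) + b + e * (u - u))) :=
      (Continuous.tendsto (by fun_prop) u).mono_left nhdsWithin_le_nhds
    have hev := hlim.eventually (Iio_mem_nhds (show _ < r by simpa using hr))
    filter_upwards [hev, self_mem_nhdsWithin, Ioo_mem_nhdsGT hu.2] with z hz hz1 hz2
    have hzu : 0 < z - u := sub_pos.2 hz1
    have := h (T - z) (T - u) (by linarith [hz2.2]) (by linarith) (by linarith [hu.1])
    have h6 : T - u - (T - z) = z - u := by ring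
    rw [h6] at this
    refine lt_of_le_of_lt ?_ hz
    rw [inv_mul_le_iff₀ hzu]
    nlinarith

end Gronwall

/-! ### Absolutely continuous curves with bounded derivative -/

section Primitive

lemma ae_Ioc_of_ae_Icc {τ T : ℝ} {p : ℝ → Prop} (hp : ∀ᵐ r ∂(volume.restrict (Set.Icc τ T)), p r) {s t : ℝ}
    (hs : τ ≤ s) (ht : t ≤ T) : ∀ᵐ r, r ∈ Set.Ioc s t → p r := by
  have := ae_restrict_of_ae_restrict_of_subset
    (show Set.Ioc s t ⊆ Set.Icc τ T from fun _ hr => ⟨hs.trans hr.1.le, hr.2.trans ht⟩) hp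
  rwa [ae_restrict_iff' measurableSet_Ioc] at this

variable {E : Type*} [NormedAddCommGroup E] [NormedSpace ℝ E]

/-- Integrability on a set, with the topology taken from the norm. -/
def BochnerIntegrableOn (f : ℝ → E) (s : Set ℝ) : Prop := IntegrableOn f s

/-- `u` is on `[τ,T]` a backward primitive of the integrable function `f` bounded by `B`. -/
structure BackwardPrimitive (τ T : ℝ) (u f : ℝ → E) (B : ℝ) : Prop where
  integrable : BochnerIntegrableOn f (Set.Icc τ T)
  eq : ∀ t ∈ Set.Icc τ T, u t = u T + ∫ s in t..T, f s
  bound_nonneg : 0 ≤ B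
  bound : ∀ᵐ s ∂(volume.restrict (Set.Icc τ T)), ‖f s‖ ≤ B

namespace BackwardPrimitive

variable {τ T B : ℝ} {u f : ℝ → E}

lemma intervalIntegrable (H : BackwardPrimitive τ T u f B) {s t : ℝ} (hs : τ ≤ s) (hst : s ≤ t)
    (ht : t ≤ T) :
    IntervalIntegrable f volume s t :=
  (intervalIntegrable_iff_integrableOn_Ioc_of_le hst).2
    (IntegrableOn.mono_set H.integrable fun _ hr => ⟨hs.trans hr.1.le, hr.2.trans ht⟩)

lemma increment (H : BackwardPrimitive τ T u f B) {s t : ℝ} (hs : τ ≤ s) (hst : s ≤ t)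
    (ht : t ≤ T) :
    u s = u t + ∫ r in s..t, f r := by
  rw [H.eq s ⟨hs, hst.trans ht⟩, H.eq t ⟨hs.trans hst, ht⟩, add_assoc, add_comm (∫ r in t..T, f r),
    intervalIntegral.integral_add_adjacent_intervals (H.intervalIntegrable hs hst ht)
      (H.intervalIntegrable (hs.trans hst) ht le_rfl)]

lemma norm_sub_le (H : BackwardPrimitive τ T u f B) {s t : ℝ} (hs : τ ≤ s) (hst : s ≤ t)
    (ht : t ≤ T) :
    ‖u s - u t‖ ≤ B * (t - s) := by
  rw [H.increment hs hst ht, add_sub_cancel_left]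
  have := intervalIntegral.norm_integral_le_of_norm_le_const_ae (a := s) (b := t) (f := f) (C := B)
    (by rw [Set.uIoc_of_le hst]; exact ae_Ioc_of_ae_Icc H.bound hs ht)
  rwa [abs_of_nonneg (sub_nonneg.2 hst)] at this

lemma continuousOn (H : BackwardPrimitive τ T u f B) : ContinuousOn u (Set.Icc τ T) := by
  refine (LipschitzOnWith.of_dist_le_mul (K := B.toNNReal) fun s hs t ht => ?_).continuousOn
  rw [Real.coe_toNNReal _ H.bound_nonneg]
  rcases le_total s t with h | h
  · rw [dist_eq_norm, dist_comm, Real.dist_eq, abs_of_nonneg (sub_nonneg.2 h)]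
    exact H.norm_sub_le hs.1 h ht.2
  · rw [dist_comm, dist_eq_norm, Real.dist_eq, abs_of_nonneg (sub_nonneg.2 h)]
    exact H.norm_sub_le ht.1 h hs.2

/-- Matrix inequalities for the derivative are integrated through scalar functionals: traces,
entries and quadratic forms. -/
lemma functional_le [CompleteSpace E] (H : BackwardPrimitive τ T u f B) (φ : E →L[ℝ] ℝ)
    {b s t : ℝ} (hs : τ ≤ s) (hst : s ≤ t) (ht : t ≤ T) (hb : ∀ᵐ r, r ∈ Set.Ioc s t → φ (f r) ≤ b) : φ (u s) ≤ φ (u t) + (t - s) * b := by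
  rw [H.increment hs hst ht, map_add,
    ← φ.intervalIntegral_comp_comm (H.intervalIntegrable hs hst ht)]
  have h1 : ∫ r in s..t, φ (f r) ≤ ∫ _r in s..t, b := by
    refine intervalIntegral.integral_mono_ae_restrict hst ?_ intervalIntegrable_const ?_
    · have := H.intervalIntegrable hs hst ht
      exact ⟨φ.integrable_comp this.1, φ.integrable_comp this.2⟩
    · rw [Filter.EventuallyLE, ← restrict_Ioc_eq_restrict_Icc, ae_restrict_iff' measurableSet_Ioc]
      exact hb
  rw [intervalIntegral.integral_const, smul_eq_mul] at h1
  linarith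

end BackwardPrimitive

end Primitive

/-! ### Weighted trace estimate -/

section TraceBound

open scoped Matrix.Norms.Frobenius
open Matrix

variable {n : ℕ}

/-- The continuous linear functional reading an entry of a matrix. -/
noncomputable def entryCLM {k l : ℕ} (i : Fin k) (j : Fin l) :
    Matrix (Fin k) (Fin l) ℝ →L[ℝ] ℝ :=
  LinearMap.toContinuousLinearMap (Matrix.entryLinearMap ℝ ℝ i j)

/-- The continuous linear functional `M ↦ tr (W M)`. -/
noncomputable def traceMul (W : Matrix (Fin n) (Fin n) ℝ) : Matrix (Fin n) (Fin n) ℝ →L[ℝ] ℝ :=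
  LinearMap.toContinuousLinearMap
    { toFun := fun M => (W * M).trace
      map_add' := fun x y => by simp [mul_add]
      map_smul' := fun c x => by simp }

lemma trace_mul_le (W M : Matrix (Fin n) (Fin n) ℝ) : (W * M).trace ≤ n * (‖W‖ * ‖M‖) :=
  (trace_le _).trans (mul_le_mul_of_nonneg_left (Matrix.frobenius_norm_mul _ _) (by positivity))

/-- A weighted trace estimate for matrix Carathéodory equations. -/
lemma trace_bound {τ T B : ℝ} {u f : ℝ → Matrix (Fin n) (Fin n) ℝ}
    (H : BackwardPrimitive τ T u f B) (hτ : 0 ≤ τ)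
    (hpsd : ∀ t ∈ Set.Icc τ T, (u t).PosSemidef) {W : ℝ → Matrix (Fin n) (Fin n) ℝ} {w L c : ℝ}
    (hw : 0 < w) (hL : 0 ≤ L) (hc : 0 ≤ c)
    (hW : ∀ t ∈ Set.Icc 0 T, (W t - w • (1 : Matrix (Fin n) (Fin n) ℝ)).PosSemidef)
    (hWL : ∀ s ∈ Set.Icc 0 T, ∀ t ∈ Set.Icc 0 T, ‖W s - W t‖ ≤ L * |s - t|)
    (hf : ∀ᵐ r ∂(volume.restrict (Set.Icc τ T)), (W r * f r).trace ≤ c * (1 + (u r).trace)) :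
    ∀ s ∈ Set.Icc τ T, (u s).trace ≤
      w⁻¹ * gronwallBound (W T * u T).trace ((c + n * (n * n) * L) * w⁻¹) c T := by
  have hB := H.bound_nonneg
  have hsub : ∀ t ∈ Set.Icc τ T, t ∈ Set.Icc 0 T := fun t ht => ⟨hτ.trans ht.1, ht.2⟩
  set φ : ℝ → ℝ := fun t => (W t * u t).trace with hφ
  have hWc : ∀ i j, ContinuousOn (fun t => W t i j) (Set.Icc τ T) := by
    refine fun i j =>
      (LipschitzOnWith.of_dist_le_mul (K := L.toNNReal) fun s hs t ht => ?_).continuousOn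
    rw [Real.dist_eq, Real.dist_eq, Real.coe_toNNReal _ hL]
    exact (abs_entry_le_norm (W s - W t) i j).trans (hWL s (hsub s hs) t (hsub t ht))
  have huc : ∀ i j, ContinuousOn (fun t => u t i j) (Set.Icc τ T) := fun i j =>
    (entryCLM i j).continuous.comp_continuousOn H.continuousOn
  have hφc : ContinuousOn φ (Set.Icc τ T) := by
    simp only [hφ, Matrix.trace, Matrix.diag, Matrix.mul_apply]
    exact continuousOn_finsetSum _ fun i _ => continuousOn_finsetSum _ fun j _ =>
      (hWc i j).mul (huc j i)
  have htrφ : ∀ t ∈ Set.Icc τ T, (u t).trace ≤ w⁻¹ * φ t := by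
    intro t ht
    have h1 := PSD.trace_mul_nonneg (hW t (hsub t ht)) (hpsd t ht)
    rw [sub_mul, Matrix.trace_sub, smul_mul_assoc, one_mul, Matrix.trace_smul, smul_eq_mul] at h1
    rw [← div_eq_inv_mul, le_div_iff₀ hw]
    simp only [hφ]; linarith
  have hn : (0 : ℝ) ≤ n := Nat.cast_nonneg n
  have step : ∀ s t, τ ≤ s → s ≤ t → t ≤ T → φ s ≤ φ t +
      (t - s) * (((c + n * (n * n) * L) * w⁻¹) * φ t + c) +
        (c * n * B + 2 * (n * L * B)) * (t - s) ^ 2 := by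
    intro s t hs hst ht
    have hsm : s ∈ Set.Icc τ T := ⟨hs, hst.trans ht⟩
    have htm : t ∈ Set.Icc τ T := ⟨hs.trans hst, ht⟩
    have hh : 0 ≤ t - s := sub_nonneg.2 hst
    -- The weight is frozen at the right end point `t`, so that only `u` is integrated. Replacing `W
    -- r` by `W t` and `u r` by `u t` costs a multiple of `t - s` in the integrand, hence a
    -- quadratic error.
    have h1 : (W t * u s).trace ≤ (W t * u t).trace + (t - s) *
        (c * (1 + (u t).trace) + (c * n * B + n * L * B) * (t - s)) :=
      H.functional_le (traceMul (W t))
      (b := c * (1 + (u t).trace) + (c * n * B + n * L * B) * (t - s)) hs hst ht (by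
        filter_upwards [ae_Ioc_of_ae_Icc hf hs ht, ae_Ioc_of_ae_Icc H.bound hs ht] with r hr1 hr2 hr
        have hrm : r ∈ Set.Icc τ T := ⟨hs.trans hr.1.le, hr.2.trans ht⟩
        have hr1 := hr1 hr
        have hr2 := hr2 hr
        have e1 : (W t * f r).trace = (W r * f r).trace + ((W t - W r) * f r).trace := by
          rw [sub_mul, Matrix.trace_sub]; ring
        have e2 : ((W t - W r) * f r).trace ≤ n * ((L * (t - s)) * B) := by
          refine (trace_mul_le _ _).trans (mul_le_mul_of_nonneg_left ?_ hn)
          refine mul_le_mul ?_ hr2 (norm_nonneg _) (by positivity)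
          refine (hWL t (hsub t htm) r (hsub r hrm)).trans (mul_le_mul_of_nonneg_left ?_ hL)
          rw [abs_of_nonneg (sub_nonneg.2 hr.2)]; linarith [hr.1]
        have e3 : (u r).trace ≤ (u t).trace + n * (B * (t - s)) := by
          have := trace_le (u r - u t)
          rw [Matrix.trace_sub] at this
          have h4 := (H.norm_sub_le hrm.1 hr.2 ht).trans
            (mul_le_mul_of_nonneg_left (show t - r ≤ t - s by linarith [hr.1]) hB)
          have h5 := mul_le_mul_of_nonneg_left h4 hn
          linarith
        change (W t * f r).trace ≤ _
        rw [e1]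
        have := mul_le_mul_of_nonneg_left e3 hc
        linarith)
    -- The change of the weight itself is of first order: it costs `L (t - s)` times the size of
    -- `u`, which gives the `L` term in the growth rate.
    have e4 : φ s = (W t * u s).trace + ((W s - W t) * u s).trace := by
      simp only [hφ]; rw [sub_mul, Matrix.trace_sub]; ring
    have e5 : ((W s - W t) * u s).trace ≤
        n * ((L * (t - s)) * (n * (n * (u t).trace) + B * (t - s))) := by
      refine (trace_mul_le _ _).trans (mul_le_mul_of_nonneg_left ?_ hn)
      refine mul_le_mul ?_ ?_ (norm_nonneg _) (by positivity)
      · have := hWL s (hsub s hsm) t (hsub t htm)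
        rwa [abs_sub_comm, abs_of_nonneg hh] at this
      · have h6 := norm_add_le (u t) (u s - u t)
        rw [add_sub_cancel] at h6
        linarith [PSD.norm_le_trace (hpsd t htm), H.norm_sub_le hs hst ht]
    have e6 := mul_le_mul_of_nonneg_left (htrφ t htm)
      (show 0 ≤ (t - s) * (c + n * (n * n) * L) by positivity)
    rw [e4]
    have e7 : φ t = (W t * u t).trace := rfl
    rw [← e7] at h1
    nlinarith
  intro s hs
  have hT : T ∈ Set.Icc τ T := ⟨hs.1.trans hs.2, le_rfl⟩
  have hφT : 0 ≤ φ T := by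
    have := htrφ T hT
    have h8 := (hpsd T hT).trace_nonneg
    have h9 := h8.trans this
    exact nonneg_of_mul_nonneg_right h9 (inv_pos.2 hw)
  refine (htrφ s hs).trans (mul_le_mul_of_nonneg_left ?_ (inv_nonneg.2 hw.le))
  refine (backward_gronwall hφc step s hs).trans ?_
  -- Enlarging `T - s` to `T` makes the bound independent of `τ`.
  refine gronwallBound_mono hφT hc (by positivity) ?_
  linarith [hτ.trans hs.1]

end TraceBound

/-! ### Calculus of uniformly bounded and Lipschitz matrix families -/

section UniformlyLipschitz

open scoped Matrix.Norms.Frobenius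
open Matrix

variable {E : Type*} [NormedAddCommGroup E] {k l p : ℕ} {𝒯 : Set ℝ} {K : Set E}

/-- A family of matrix-valued maps on `K` that is bounded and Lipschitz uniformly in `t ∈ 𝒯`. -/
def UnifLip (𝒯 : Set ℝ) (K : Set E) (g : ℝ → E → Matrix (Fin k) (Fin l) ℝ) : Prop :=
  ∃ c, 0 ≤ c ∧ ∀ t ∈ 𝒯, (∀ x ∈ K, ‖g t x‖ ≤ c) ∧
    ∀ x ∈ K, ∀ y ∈ K, ‖g t x - g t y‖ ≤ c * ‖x - y‖

namespace UnifLip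

variable {g g' : ℝ → E → Matrix (Fin k) (Fin l) ℝ}

lemma add (h : UnifLip 𝒯 K g) (h' : UnifLip 𝒯 K g') : UnifLip 𝒯 K fun t x => g t x + g' t x := by
  obtain ⟨c, hc, H⟩ := h
  obtain ⟨d, hd, H'⟩ := h'
  refine ⟨c + d, by positivity, fun t ht => ⟨fun x hx => (norm_add_le _ _).trans
    (add_le_add ((H t ht).1 x hx) ((H' t ht).1 x hx)), fun x hx y hy => ?_⟩⟩
  rw [add_sub_add_comm, add_mul]
  exact (norm_add_le _ _).trans (add_le_add ((H t ht).2 x hx y hy) ((H' t ht).2 x hx y hy))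

lemma neg (h : UnifLip 𝒯 K g) : UnifLip 𝒯 K fun t x => -g t x := by
  obtain ⟨c, hc, H⟩ := h
  refine ⟨c, hc, fun t ht => ⟨fun x hx => ?_, fun x hx y hy => ?_⟩⟩
  · rw [norm_neg]; exact (H t ht).1 x hx
  · rw [neg_sub_neg, norm_sub_rev]; exact (H t ht).2 x hx y hy

lemma sub (h : UnifLip 𝒯 K g) (h' : UnifLip 𝒯 K g') : UnifLip 𝒯 K fun t x => g t x - g' t x := by
  simpa only [sub_eq_add_neg] using h.add h'.neg

lemma transpose (h : UnifLip 𝒯 K g) : UnifLip 𝒯 K fun t x => (g t x)ᵀ := by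
  obtain ⟨c, hc, H⟩ := h
  refine ⟨c, hc, fun t ht => ⟨fun x hx => ?_, fun x hx y hy => ?_⟩⟩
  · rw [Matrix.frobenius_norm_transpose]; exact (H t ht).1 x hx
  · rw [← Matrix.transpose_sub, Matrix.frobenius_norm_transpose]; exact (H t ht).2 x hx y hy

lemma mul {g' : ℝ → E → Matrix (Fin l) (Fin p) ℝ} (h : UnifLip 𝒯 K g) (h' : UnifLip 𝒯 K g') :
    UnifLip 𝒯 K fun t x => g t x * g' t x := by
  obtain ⟨c, hc, H⟩ := h
  obtain ⟨d, hd, H'⟩ := h'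
  refine ⟨c * d + 2 * (c * d), by positivity, fun t ht => ⟨fun x hx => ?_, fun x hx y hy => ?_⟩⟩
  · refine (Matrix.frobenius_norm_mul _ _).trans ?_
    have := mul_le_mul ((H t ht).1 x hx) ((H' t ht).1 x hx) (norm_nonneg _) hc
    have : 0 ≤ c * d := by positivity
    linarith
  · have e : g t x * g' t x - g t y * g' t y =
        (g t x - g t y) * g' t x + g t y * (g' t x - g' t y) := by
      rw [Matrix.sub_mul, Matrix.mul_sub]; abel
    rw [e]
    refine (norm_add_le _ _).trans ?_
    have h1 := (Matrix.frobenius_norm_mul (g t x - g t y) (g' t x)).trans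
      (mul_le_mul ((H t ht).2 x hx y hy) ((H' t ht).1 x hx) (norm_nonneg _) (by positivity))
    have h2 := (Matrix.frobenius_norm_mul (g t y) (g' t x - g' t y)).trans
      (mul_le_mul ((H t ht).1 y hy) ((H' t ht).2 x hx y hy) (norm_nonneg _) hc)
    have : 0 ≤ c * d * ‖x - y‖ := by positivity
    nlinarith

lemma const {M : ℝ → Matrix (Fin k) (Fin l) ℝ} {c : ℝ} (h : ∀ t ∈ 𝒯, ‖M t‖ ≤ c) :
    UnifLip 𝒯 K fun t _ => M t := by
  refine ⟨max c 0, le_max_right _ _, fun t ht => ⟨fun x _ => (h t ht).trans (le_max_left _ _),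
    fun x _ y _ => ?_⟩⟩
  rw [sub_self, norm_zero]; positivity

/-- Coercivity bounds the inverses uniformly, and `X⁻¹ - Y⁻¹ = X⁻¹ (Y - X) Y⁻¹` transfers the
Lipschitz bound. -/
lemma inv {g : ℝ → E → Matrix (Fin k) (Fin k) ℝ} (h : UnifLip 𝒯 K g) {δ : ℝ} (hδ : 0 < δ)
    (hco : ∀ t ∈ 𝒯, ∀ x ∈ K, (g t x - δ • (1 : Matrix (Fin k) (Fin k) ℝ)).PosSemidef) :
    UnifLip 𝒯 K fun t x => (g t x)⁻¹ := by
  obtain ⟨c, hc, H⟩ := h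
  set d : ℝ := k * (k * δ⁻¹) with hd
  have hd0 : 0 ≤ d := by positivity
  refine ⟨d + d * c * d, by positivity, fun t ht => ⟨fun x hx => ?_, fun x hx y hy => ?_⟩⟩
  · have := norm_inv_le_of_coercive hδ (hco t ht x hx)
    have : 0 ≤ d * c * d := by positivity
    linarith
  · have hx' := norm_inv_le_of_coercive hδ (hco t ht x hx)
    have hy' := norm_inv_le_of_coercive hδ (hco t ht y hy)
    have ux : IsUnit (g t x).det :=
      (Matrix.isUnit_iff_isUnit_det _).1 (posDef_of_coercive hδ (hco t ht x hx)).isUnit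
    have uy : IsUnit (g t y).det :=
      (Matrix.isUnit_iff_isUnit_det _).1 (posDef_of_coercive hδ (hco t ht y hy)).isUnit
    have e : (g t x)⁻¹ - (g t y)⁻¹ = (g t x)⁻¹ * (g t y - g t x) * (g t y)⁻¹ := by
      rw [mul_sub, sub_mul, Matrix.nonsing_inv_mul _ ux, mul_assoc, Matrix.mul_nonsing_inv _ uy,
        mul_one, one_mul]
    rw [e]
    have h1 : ‖(g t x)⁻¹ * (g t y - g t x) * (g t y)⁻¹‖ ≤ d * (c * ‖x - y‖) * d := by
      refine (Matrix.frobenius_norm_mul _ _).trans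
        (mul_le_mul ((Matrix.frobenius_norm_mul _ _).trans ?_) hy' (norm_nonneg _) (by positivity))
      refine mul_le_mul hx' ?_ (norm_nonneg _) hd0
      rw [norm_sub_rev]; exact (H t ht).2 x hx y hy
    have : 0 ≤ d * ‖x - y‖ := by positivity
    nlinarith

end UnifLip

end UniformlyLipschitz

/-! ### Entrywise measurability and integrability of matrix functions -/

section Measurability

variable {μ : Measure ℝ} {k l p : ℕ}

/-- All entries of the matrix function are almost everywhere measurable. -/
def EntriesMeas (μ : Measure ℝ) (M : ℝ → Matrix (Fin k) (Fin l) ℝ) : Prop :=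
  ∀ i j, AEMeasurable (fun t => M t i j) μ

namespace EntriesMeas

variable {M N : ℝ → Matrix (Fin k) (Fin l) ℝ}

lemma add (hM : EntriesMeas μ M) (hN : EntriesMeas μ N) : EntriesMeas μ fun t => M t + N t :=
  fun i j => (hM i j).add (hN i j)

lemma sub (hM : EntriesMeas μ M) (hN : EntriesMeas μ N) : EntriesMeas μ fun t => M t - N t :=
  fun i j => (hM i j).sub (hN i j)

lemma neg (hM : EntriesMeas μ M) : EntriesMeas μ fun t => -M t :=
  fun i j => (hM i j).neg

lemma transpose (hM : EntriesMeas μ M) : EntriesMeas μ fun t => (M t)ᵀ :=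
  fun i j => hM j i

lemma mul {N : ℝ → Matrix (Fin l) (Fin p) ℝ} (hM : EntriesMeas μ M) (hN : EntriesMeas μ N) :
    EntriesMeas μ fun t => M t * N t := by
  intro i j
  simp only [Matrix.mul_apply]
  exact Finset.aemeasurable_fun_sum _ fun a _ => (hM i a).mul (hN a j)

lemma det {M : ℝ → Matrix (Fin k) (Fin k) ℝ} (hM : EntriesMeas μ M) :
    AEMeasurable (fun t => (M t).det) μ := by
  simp only [Matrix.det_apply']
  exact Finset.aemeasurable_fun_sum _ fun σ _ =>
    aemeasurable_const.mul (Finset.aemeasurable_fun_prod _ fun i _ => hM (σ i) i)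

/-- By Cramer's rule the entries are cofactors times the scalar inverse of the determinant.
Invertibility is not needed, since scalar inversion is measurable everywhere. -/
lemma inv {M : ℝ → Matrix (Fin k) (Fin k) ℝ} (hM : EntriesMeas μ M) :
    EntriesMeas μ fun t => (M t)⁻¹ := by
  intro i j
  simp only [Matrix.inv_def, Matrix.smul_apply, smul_eq_mul, Ring.inverse_eq_inv',
    Matrix.adjugate_apply]
  refine hM.det.inv.mul (det fun a b => ?_)
  by_cases h : a = j
  · subst h; simp only [Matrix.updateRow_self]; exact aemeasurable_const
  · simp only [Matrix.updateRow_ne h]; exact hM a b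

open scoped Matrix.Norms.Frobenius in
lemma aestronglyMeasurable (hM : EntriesMeas μ M) : AEStronglyMeasurable M μ := by
  have e : M = fun t => ∑ i, ∑ j, M t i j • Matrix.single i j (1 : ℝ) := by
    funext t
    conv_lhs => rw [Matrix.matrix_eq_sum_single (M t)]
    simp
  rw [e]
  refine Finset.aestronglyMeasurable_fun_sum _ fun i _ =>
    Finset.aestronglyMeasurable_fun_sum _ fun j _ => ?_
  exact (hM i j).aestronglyMeasurable.smul_const _

end EntriesMeas

open scoped Matrix.Norms.Frobenius in
lemma bochnerIntegrableOn_of_entries {M : ℝ → Matrix (Fin k) (Fin l) ℝ} {s : Set ℝ}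
    (hM : ∀ i j, IntegrableOn (fun t => M t i j) s) : BochnerIntegrableOn M s := by
  have e : M = fun t => ∑ i, ∑ j, M t i j • Matrix.single i j (1 : ℝ) := by
    funext t
    conv_lhs => rw [Matrix.matrix_eq_sum_single (M t)]
    simp
  rw [e]
  exact integrable_finsetSum _ fun i _ => integrable_finsetSum _ fun j _ => (hM i j).smul_const _

open scoped Matrix.Norms.Frobenius in
lemma intervalIntegral_apply {M : ℝ → Matrix (Fin k) (Fin l) ℝ} {a b : ℝ} {s : Set ℝ}
    (hM : BochnerIntegrableOn M s) (hs : Set.Ioc a b ⊆ s) (hab : a ≤ b) (i : Fin k) (j : Fin l) :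
    (∫ t in a..b, M t) i j = ∫ t in a..b, M t i j :=
  ((entryCLM i j).intervalIntegral_comp_comm
    ((intervalIntegrable_iff_integrableOn_Ioc_of_le hab).2 (IntegrableOn.mono_set hM hs))).symm

end Measurability

/-! ### Algebra, regularity and measurability of the Riccati right-hand sides -/

section Coefficients

open scoped Matrix.Norms.Frobenius
open Matrix

variable {n m₁ m₂ : ℕ}

lemma MatrixLInfty.exists_bound {k l : ℕ} {T : ℝ} {M : ℝ → Matrix (Fin k) (Fin l) ℝ}
    (h : MatrixLInfty T M) : ∃ c, 0 ≤ c ∧ ∀ᵐ t ∂(volume.restrict (Set.Icc 0 T)), ‖M t‖ ≤ c := by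
  have h1 : ∀ i j, ∃ c : ℝ, ∀ᵐ t ∂(volume.restrict (Set.Icc 0 T)), |M t i j| ≤ c := by
    intro i j
    refine ⟨(eLpNormEssSup (fun t => M t i j) (volume.restrict (Set.Icc 0 T))).toReal, ?_⟩
    have hlt : eLpNormEssSup (fun t => M t i j) (volume.restrict (Set.Icc 0 T)) < ⊤ := by
      have := (h i j).eLpNorm_lt_top
      rwa [eLpNorm_exponent_top] at this
    filter_upwards [ae_le_eLpNormEssSup (f := fun t => M t i j)
      (μ := volume.restrict (Set.Icc 0 T))] with t ht
    have := ENNReal.toReal_mono hlt.ne ht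
    simpa using this
  choose c hc using h1
  refine ⟨∑ i, ∑ j, |c i j|, by positivity, ?_⟩
  have h2 : ∀ᵐ t ∂(volume.restrict (Set.Icc 0 T)), ∀ i j, |M t i j| ≤ c i j :=
    ae_all_iff.2 fun i => ae_all_iff.2 fun j => hc i j
  filter_upwards [h2] with t ht
  exact (norm_le_sum_abs _).trans (Finset.sum_le_sum fun i _ => Finset.sum_le_sum fun j _ =>
    (ht i j).trans (le_abs_self _))

lemma MatrixLInfty.entriesMeas {k l : ℕ} {T : ℝ} {M : ℝ → Matrix (Fin k) (Fin l) ℝ}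
    (h : MatrixLInfty T M) : EntriesMeas (volume.restrict (Set.Icc 0 T)) M :=
  fun i j => (h i j).aestronglyMeasurable.aemeasurable

/-- The coefficients at time `t` are bounded by `c`, and the weights satisfy the positivity
conditions with constant `δ`. -/
structure GoodTime (S : LQGame n m₁ m₂) (c δ : ℝ) (t : ℝ) : Prop where
  A : ‖S.A t‖ ≤ c
  B₁ : ‖S.B₁ t‖ ≤ c
  B₂ : ‖S.B₂ t‖ ≤ c
  C : ‖S.C t‖ ≤ c
  D₁ : ‖S.D₁ t‖ ≤ c
  D₂ : ‖S.D₂ t‖ ≤ c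
  Q₁ : ‖S.Q₁ t‖ ≤ c
  Q₂ : ‖S.Q₂ t‖ ≤ c
  R₁ : ‖S.R₁ t‖ ≤ c
  R₂ : ‖S.R₂ t‖ ≤ c
  Q₁_psd : (S.Q₁ t).PosSemidef
  Q₂_psd : (S.Q₂ t).PosSemidef
  R₁_coercive : (S.R₁ t - δ • (1 : Matrix (Fin m₁) (Fin m₁) ℝ)).PosSemidef
  R₂_coercive : (S.R₂ t - δ • (1 : Matrix (Fin m₂) (Fin m₂) ℝ)).PosSemidef

lemma exists_goodTime {S : LQGame n m₁ m₂} {T : ℝ} (hb : S.BoundedCoefficients T)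
    (hp : S.Positivity T) : ∃ c δ : ℝ, 0 ≤ c ∧ 0 < δ ∧
      ∀ᵐ t ∂(volume.restrict (Set.Icc 0 T)), S.GoodTime c δ t := by
  obtain ⟨_, _, hQ, δ, hδ, hR⟩ := hp
  obtain ⟨a₁, _, h₁⟩ := MatrixLInfty.exists_bound hb.A
  obtain ⟨a₂, _, h₂⟩ := MatrixLInfty.exists_bound hb.B₁
  obtain ⟨a₃, _, h₃⟩ := MatrixLInfty.exists_bound hb.B₂
  obtain ⟨a₄, _, h₄⟩ := MatrixLInfty.exists_bound hb.C
  obtain ⟨a₅, _, h₅⟩ := MatrixLInfty.exists_bound hb.D₁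
  obtain ⟨a₆, _, h₆⟩ := MatrixLInfty.exists_bound hb.D₂
  obtain ⟨a₇, _, h₇⟩ := MatrixLInfty.exists_bound hb.Q₁
  obtain ⟨a₈, _, h₈⟩ := MatrixLInfty.exists_bound hb.Q₂
  obtain ⟨a₉, _, h₉⟩ := MatrixLInfty.exists_bound hb.R₁
  obtain ⟨a₀, _, h₀⟩ := MatrixLInfty.exists_bound hb.R₂
  refine ⟨a₁ + a₂ + a₃ + a₄ + a₅ + a₆ + a₇ + a₈ + a₉ + a₀, δ, by positivity, hδ, ?_⟩
  filter_upwards [hQ, hR, h₁, h₂, h₃, h₄, h₅, h₆, h₇, h₈, h₉, h₀] with t q r k₁ k₂ k₃ k₄ k₅ k₆ k₇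
    k₈ k₉ k₀
  constructor <;> first | exact q.1 | exact q.2 | exact r.1 | exact r.2 | linarith

/-- The drift `A - B₂ N (B₂ᵀ P₂ + D₂ᵀ P₂ C)` obtained from the follower's response to `Θ₁ = 0`. -/
noncomputable def A₀ (S : LQGame n m₁ m₂) (t : ℝ) (P₂ : Matrix (Fin n) (Fin n) ℝ) :
    Matrix (Fin n) (Fin n) ℝ :=
  S.A t - S.B₂ t * S.N₂ t P₂ * ((S.B₂ t)ᵀ * P₂ + (S.D₂ t)ᵀ * P₂ * S.C t)

/-- The diffusion `C - D₂ N (B₂ᵀ P₂ + D₂ᵀ P₂ C)` obtained from the follower's response to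
`Θ₁ = 0`. -/
noncomputable def C₀ (S : LQGame n m₁ m₂) (t : ℝ) (P₂ : Matrix (Fin n) (Fin n) ℝ) :
    Matrix (Fin n) (Fin n) ℝ :=
  S.C t - S.D₂ t * S.N₂ t P₂ * ((S.B₂ t)ᵀ * P₂ + (S.D₂ t)ᵀ * P₂ * S.C t)

lemma coercive_add {k : ℕ} {R X : Matrix (Fin k) (Fin k) ℝ} {δ : ℝ}
    (h : (R - δ • (1 : Matrix (Fin k) (Fin k) ℝ)).PosSemidef) (hX : X.PosSemidef) :
    (R + X - δ • (1 : Matrix (Fin k) (Fin k) ℝ)).PosSemidef := by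
  rw [add_sub_right_comm]; exact h.add hX

/-- Completion of the square in a stochastic Lyapunov operator. -/
lemma complete_square {m : ℕ} {A C P : Matrix (Fin n) (Fin n) ℝ} {B D : Matrix (Fin n) (Fin m) ℝ}
    {R : Matrix (Fin m) (Fin m) ℝ} {θ : Matrix (Fin m) (Fin n) ℝ} {δ : ℝ} (hδ : 0 < δ)
    (hP : P.PosSemidef) (hR : (R - δ • (1 : Matrix (Fin m) (Fin m) ℝ)).PosSemidef)
    (hθ : θ = -((R + Dᵀ * P * D)⁻¹ * (Bᵀ * P + Dᵀ * P * C))) :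
    (A + B * θ)ᵀ * P + P * (A + B * θ) + (C + D * θ)ᵀ * P * (C + D * θ) + θᵀ * R * θ =
      Aᵀ * P + P * A + Cᵀ * P * C - θᵀ * (R + Dᵀ * P * D) * θ := by
  have hK := coercive_add hR (PSD.conj hP D)
  have hdet : IsUnit (R + Dᵀ * P * D).det :=
    (Matrix.isUnit_iff_isUnit_det _).1 (posDef_of_coercive hδ hK).isUnit
  have hKs := transpose_eq_of_coercive hK
  have h1 : (R + Dᵀ * P * D) * θ = -(Bᵀ * P + Dᵀ * P * C) := by
    rw [hθ, Matrix.mul_neg, Matrix.mul_nonsing_inv_cancel_left _ _ hdet]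
  have hPs := PSD.transpose_eq hP
  have h2 : θᵀ * (R + Dᵀ * P * D) = -(P * B + Cᵀ * P * D) := by
    have := congrArg Matrix.transpose h1
    rw [Matrix.transpose_mul, hKs] at this
    rw [this]
    simp [Matrix.transpose_mul, hPs, Matrix.mul_assoc]
  have h3 : θᵀ * (R + Dᵀ * P * D) * θ + θᵀ * (Bᵀ * P + Dᵀ * P * C) = 0 := by
    rw [Matrix.mul_assoc, h1, Matrix.mul_neg]; simp
  have h4 : θᵀ * (R + Dᵀ * P * D) * θ + (P * B + Cᵀ * P * D) * θ = 0 := by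
    rw [h2, Matrix.neg_mul]; simp
  have h5 : (A + B * θ)ᵀ * P + P * (A + B * θ) + (C + D * θ)ᵀ * P * (C + D * θ) + θᵀ * R * θ =
      Aᵀ * P + P * A + Cᵀ * P * C - θᵀ * (R + Dᵀ * P * D) * θ +
      ((θᵀ * (R + Dᵀ * P * D) * θ + θᵀ * (Bᵀ * P + Dᵀ * P * C)) +
      (θᵀ * (R + Dᵀ * P * D) * θ + (P * B + Cᵀ * P * D) * θ)) := by
    simp only [Matrix.transpose_add, Matrix.transpose_mul, Matrix.add_mul, Matrix.mul_add,
      Matrix.mul_assoc]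
    abel
  rw [h5, h3, h4]; simp

/-- `Θ₁` is the minimizer that completes the square, so the feedback enters only through a negative
semidefinite term. Upper bounds on `P₁` thus see only `A₀` and `C₀`. -/
lemma F₁_eq {S : LQGame n m₁ m₂} {c δ t : ℝ} (hδ : 0 < δ) (hg : S.GoodTime c δ t)
    {P₁ P₂ : Matrix (Fin n) (Fin n) ℝ} (h₁ : P₁.PosSemidef) :
    S.F₁ t P₁ P₂ = (S.A₀ t P₂)ᵀ * P₁ + P₁ * S.A₀ t P₂ + (S.C₀ t P₂)ᵀ * P₁ * S.C₀ t P₂ + S.Q₁ t -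
      (S.Θ₁ t P₁ P₂)ᵀ * (S.R₁ t + (S.bD t P₂)ᵀ * P₁ * S.bD t P₂) * S.Θ₁ t P₁ P₂ := by
  have := complete_square (A := S.A₀ t P₂) (C := S.C₀ t P₂) (B := S.bB t P₂) (D := S.bD t P₂)
    (θ := S.Θ₁ t P₁ P₂) hδ h₁ hg.R₁_coercive rfl
  rw [add_sub_right_comm, ← this]
  simp only [F₁, bA, bC, A₀, C₀]
  abel

/-- Here the square is completed in the follower's response. The remaining Lyapunov operator
contains no `N₂`, so a bound on `Θ₁` alone controls its coefficients. -/
lemma F₂_eq {S : LQGame n m₁ m₂} {c δ t : ℝ} (hδ : 0 < δ) (hg : S.GoodTime c δ t)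
    {P₁ P₂ : Matrix (Fin n) (Fin n) ℝ} (h₂ : P₂.PosSemidef) :
    S.F₂ t P₁ P₂ = (S.A t + S.B₁ t * S.Θ₁ t P₁ P₂)ᵀ * P₂ + P₂ * (S.A t + S.B₁ t * S.Θ₁ t P₁ P₂) +
      (S.C t + S.D₁ t * S.Θ₁ t P₁ P₂)ᵀ * P₂ * (S.C t + S.D₁ t * S.Θ₁ t P₁ P₂) + S.Q₂ t -
      (S.Θ₂ t (S.Θ₁ t P₁ P₂) P₂)ᵀ * (S.R₂ t + (S.D₂ t)ᵀ * P₂ * S.D₂ t) *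
        S.Θ₂ t (S.Θ₁ t P₁ P₂) P₂ := by
  have := complete_square (A := S.A t + S.B₁ t * S.Θ₁ t P₁ P₂)
    (C := S.C t + S.D₁ t * S.Θ₁ t P₁ P₂) (B := S.B₂ t) (D := S.D₂ t)
    (θ := S.Θ₂ t (S.Θ₁ t P₁ P₂) P₂) hδ h₂ hg.R₂_coercive rfl
  have hA : S.bA t (S.Θ₁ t P₁ P₂) P₂ = S.A t + S.B₁ t * S.Θ₁ t P₁ P₂ +
      S.B₂ t * S.Θ₂ t (S.Θ₁ t P₁ P₂) P₂ := by
    simp only [bA, bB, Θ₂, Matrix.mul_add, Matrix.sub_mul, Matrix.mul_neg,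
      Matrix.mul_assoc]
    abel
  have hC : S.bC t (S.Θ₁ t P₁ P₂) P₂ = S.C t + S.D₁ t * S.Θ₁ t P₁ P₂ +
      S.D₂ t * S.Θ₂ t (S.Θ₁ t P₁ P₂) P₂ := by
    simp only [bC, bD, Θ₂, Matrix.mul_add, Matrix.sub_mul, Matrix.mul_neg,
      Matrix.mul_assoc]
    abel
  rw [add_sub_right_comm, ← this, ← hA, ← hC]
  simp only [F₂]
  abel

/-- A Lyapunov operator with nonnegative source term is quasi-positive on the cone of positive
semidefinite matrices. -/
lemma lyapunov_quasi_positive {P X Y Z : Matrix (Fin n) (Fin n) ℝ} (hP : P.PosSemidef)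
    (hZ : Z.PosSemidef) {h : ℝ} (hh : 0 ≤ h) :
    (P + h • (Xᵀ * P + P * X + Yᵀ * P * Y + Z) + h ^ 2 • (Xᵀ * P * X)).PosSemidef := by
  -- The expression equals `(1 + hX)ᵀ P (1 + hX) + h (Yᵀ P Y + Z)`; the quadratic term in the
  -- statement completes this congruence.
  have h1 := (PSD.conj hP (1 + h • X)).add (((PSD.conj hP Y).add hZ).smul hh)
  convert h1 using 1
  simp only [Matrix.transpose_add, Matrix.transpose_one, Matrix.transpose_smul, add_mul, mul_add,
    one_mul, mul_one, smul_mul_assoc, mul_smul_comm, smul_add, smul_smul, pow_two, mul_assoc]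
  abel

/-- Pairs of positive semidefinite matrices of norm at most `R`. -/
def psdBall (n : ℕ) (R : ℝ) : Set (Matrix (Fin n) (Fin n) ℝ × Matrix (Fin n) (Fin n) ℝ) :=
  {x | x.1.PosSemidef ∧ x.2.PosSemidef ∧ ‖x‖ ≤ R}

lemma unifLip_fst (𝒯 : Set ℝ) (R : ℝ) : UnifLip 𝒯 (psdBall n R) fun _ x => x.1 := by
  refine ⟨max R 1, le_max_of_le_right zero_le_one, fun t _ =>
    ⟨fun x hx => ((norm_fst_le x).trans hx.2.2).trans (le_max_left _ _), fun x _ y _ => ?_⟩⟩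
  rw [← Prod.fst_sub]
  exact (norm_fst_le _).trans (le_mul_of_one_le_left (norm_nonneg _) (le_max_right _ _))

lemma unifLip_snd (𝒯 : Set ℝ) (R : ℝ) : UnifLip 𝒯 (psdBall n R) fun _ x => x.2 := by
  refine ⟨max R 1, le_max_of_le_right zero_le_one, fun t _ =>
    ⟨fun x hx => ((norm_snd_le x).trans hx.2.2).trans (le_max_left _ _), fun x _ y _ => ?_⟩⟩
  rw [← Prod.snd_sub]
  exact (norm_snd_le _).trans (le_mul_of_one_le_left (norm_nonneg _) (le_max_right _ _))

section UnifLip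

variable {S : LQGame n m₁ m₂} {c δ : ℝ} (R : ℝ)

lemma unifLip_N₂ (hδ : 0 < δ) :
    UnifLip {t | S.GoodTime c δ t} (psdBall n R) fun t x => S.N₂ t x.2 := by
  have hD : UnifLip {t | S.GoodTime c δ t} (psdBall n R) fun t _ => S.D₂ t :=
    UnifLip.const fun _ h => h.D₂
  have hR : UnifLip {t | S.GoodTime c δ t} (psdBall n R) fun t _ => S.R₂ t :=
    UnifLip.const fun _ h => h.R₂
  exact (hR.add ((hD.transpose.mul (unifLip_snd _ R)).mul hD)).inv hδ fun t ht x hx =>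
    coercive_add ht.R₂_coercive (PSD.conj hx.2.1 _)

lemma unifLip_coefficients (hδ : 0 < δ) :
    UnifLip {t | S.GoodTime c δ t} (psdBall n R) (fun t x => S.bB t x.2) ∧
    UnifLip {t | S.GoodTime c δ t} (psdBall n R) (fun t x => S.bD t x.2) ∧
    UnifLip {t | S.GoodTime c δ t} (psdBall n R) (fun t x => S.A₀ t x.2) ∧
    UnifLip {t | S.GoodTime c δ t} (psdBall n R) (fun t x => S.C₀ t x.2) := by
  have hN := unifLip_N₂ (S := S) (c := c) R hδ
  have hP := unifLip_snd (n := n) {t | S.GoodTime c δ t} R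
  have hA : UnifLip {t | S.GoodTime c δ t} (psdBall n R) fun t _ => S.A t :=
    UnifLip.const fun _ h => h.A
  have hC : UnifLip {t | S.GoodTime c δ t} (psdBall n R) fun t _ => S.C t :=
    UnifLip.const fun _ h => h.C
  have hB₁ : UnifLip {t | S.GoodTime c δ t} (psdBall n R) fun t _ => S.B₁ t :=
    UnifLip.const fun _ h => h.B₁
  have hB₂ : UnifLip {t | S.GoodTime c δ t} (psdBall n R) fun t _ => S.B₂ t :=
    UnifLip.const fun _ h => h.B₂
  have hD₁ : UnifLip {t | S.GoodTime c δ t} (psdBall n R) fun t _ => S.D₁ t :=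
    UnifLip.const fun _ h => h.D₁
  have hD₂ : UnifLip {t | S.GoodTime c δ t} (psdBall n R) fun t _ => S.D₂ t :=
    UnifLip.const fun _ h => h.D₂
  have h1 := (hD₂.transpose.mul hP).mul hD₁
  have h2 := (hB₂.transpose.mul hP).add ((hD₂.transpose.mul hP).mul hC)
  exact ⟨hB₁.sub ((hB₂.mul hN).mul h1), hD₁.sub ((hD₂.mul hN).mul h1),
    hA.sub ((hB₂.mul hN).mul h2), hC.sub ((hD₂.mul hN).mul h2)⟩

lemma unifLip_Θ₁ (hδ : 0 < δ) :
    UnifLip {t | S.GoodTime c δ t} (psdBall n R) fun t x => S.Θ₁ t x.1 x.2 := by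
  obtain ⟨hB, hD, -, hC⟩ := unifLip_coefficients (S := S) (c := c) R hδ
  have hP := unifLip_fst (n := n) {t | S.GoodTime c δ t} R
  have hR : UnifLip {t | S.GoodTime c δ t} (psdBall n R) fun t _ => S.R₁ t :=
    UnifLip.const fun _ h => h.R₁
  exact (((hR.add ((hD.transpose.mul hP).mul hD)).inv hδ fun t ht x hx =>
    coercive_add ht.R₁_coercive (PSD.conj hx.1 _)).mul
      ((hB.transpose.mul hP).add ((hD.transpose.mul hP).mul hC))).neg

lemma unifLip_Θ₂ (hδ : 0 < δ) : UnifLip {t | S.GoodTime c δ t} (psdBall n R)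
    fun t x => S.Θ₂ t (S.Θ₁ t x.1 x.2) x.2 := by
  have hN := unifLip_N₂ (S := S) (c := c) R hδ
  have hP := unifLip_snd (n := n) {t | S.GoodTime c δ t} R
  have hΘ := unifLip_Θ₁ (S := S) (c := c) R hδ
  have hC : UnifLip {t | S.GoodTime c δ t} (psdBall n R) fun t _ => S.C t :=
    UnifLip.const fun _ h => h.C
  have hB₂ : UnifLip {t | S.GoodTime c δ t} (psdBall n R) fun t _ => S.B₂ t :=
    UnifLip.const fun _ h => h.B₂
  have hD₁ : UnifLip {t | S.GoodTime c δ t} (psdBall n R) fun t _ => S.D₁ t :=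
    UnifLip.const fun _ h => h.D₁
  have hD₂ : UnifLip {t | S.GoodTime c δ t} (psdBall n R) fun t _ => S.D₂ t :=
    UnifLip.const fun _ h => h.D₂
  exact (hN.mul ((hB₂.transpose.mul hP).add
    ((hD₂.transpose.mul hP).mul (hC.add (hD₁.mul hΘ))))).neg

lemma unifLip_bA (hδ : 0 < δ) : UnifLip {t | S.GoodTime c δ t} (psdBall n R)
    fun t x => S.bA t (S.Θ₁ t x.1 x.2) x.2 := by
  obtain ⟨hB, -, hA, -⟩ := unifLip_coefficients (S := S) (c := c) R hδ
  exact hA.add (hB.mul (unifLip_Θ₁ R hδ))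

lemma unifLip_bC (hδ : 0 < δ) : UnifLip {t | S.GoodTime c δ t} (psdBall n R)
    fun t x => S.bC t (S.Θ₁ t x.1 x.2) x.2 := by
  obtain ⟨-, hD, -, hC⟩ := unifLip_coefficients (S := S) (c := c) R hδ
  exact hC.add (hD.mul (unifLip_Θ₁ R hδ))

lemma unifLip_F₁ (hδ : 0 < δ) : UnifLip {t | S.GoodTime c δ t} (psdBall n R)
    fun t x => S.F₁ t x.1 x.2 := by
  have hA := unifLip_bA (S := S) (c := c) R hδ
  have hC := unifLip_bC (S := S) (c := c) R hδ
  have hP := unifLip_fst (n := n) {t | S.GoodTime c δ t} R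
  have hΘ := unifLip_Θ₁ (S := S) (c := c) R hδ
  have hQ : UnifLip {t | S.GoodTime c δ t} (psdBall n R) fun t _ => S.Q₁ t :=
    UnifLip.const fun _ h => h.Q₁
  have hR : UnifLip {t | S.GoodTime c δ t} (psdBall n R) fun t _ => S.R₁ t :=
    UnifLip.const fun _ h => h.R₁
  exact ((((hA.transpose.mul hP).add (hP.mul hA)).add ((hC.transpose.mul hP).mul hC)).add hQ).add
    ((hΘ.transpose.mul hR).mul hΘ)

lemma unifLip_F₂ (hδ : 0 < δ) : UnifLip {t | S.GoodTime c δ t} (psdBall n R)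
    fun t x => S.F₂ t x.1 x.2 := by
  have hA := unifLip_bA (S := S) (c := c) R hδ
  have hC := unifLip_bC (S := S) (c := c) R hδ
  have hP := unifLip_snd (n := n) {t | S.GoodTime c δ t} R
  have hΘ := unifLip_Θ₂ (S := S) (c := c) R hδ
  have hQ : UnifLip {t | S.GoodTime c δ t} (psdBall n R) fun t _ => S.Q₂ t :=
    UnifLip.const fun _ h => h.Q₂
  have hR : UnifLip {t | S.GoodTime c δ t} (psdBall n R) fun t _ => S.R₂ t :=
    UnifLip.const fun _ h => h.R₂
  exact ((((hA.transpose.mul hP).add (hP.mul hA)).add ((hC.transpose.mul hP).mul hC)).add hQ).add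
    ((hΘ.transpose.mul hR).mul hΘ)

end UnifLip

lemma entriesMeas_F {S : LQGame n m₁ m₂} {T : ℝ} (hb : S.BoundedCoefficients T)
    {P₁ P₂ : ℝ → Matrix (Fin n) (Fin n) ℝ}
    (h₁ : EntriesMeas (volume.restrict (Set.Icc 0 T)) P₁)
    (h₂ : EntriesMeas (volume.restrict (Set.Icc 0 T)) P₂) :
    EntriesMeas (volume.restrict (Set.Icc 0 T)) (fun t => S.F₁ t (P₁ t) (P₂ t)) ∧
    EntriesMeas (volume.restrict (Set.Icc 0 T)) (fun t => S.F₂ t (P₁ t) (P₂ t)) := by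
  have A := MatrixLInfty.entriesMeas hb.A
  have B₁ := MatrixLInfty.entriesMeas hb.B₁
  have B₂ := MatrixLInfty.entriesMeas hb.B₂
  have C := MatrixLInfty.entriesMeas hb.C
  have D₁ := MatrixLInfty.entriesMeas hb.D₁
  have D₂ := MatrixLInfty.entriesMeas hb.D₂
  have Q₁ := MatrixLInfty.entriesMeas hb.Q₁
  have Q₂ := MatrixLInfty.entriesMeas hb.Q₂
  have R₁ := MatrixLInfty.entriesMeas hb.R₁
  have R₂ := MatrixLInfty.entriesMeas hb.R₂
  have D₂P := D₂.transpose.mul h₂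
  have N : EntriesMeas _ fun t => S.N₂ t (P₂ t) := (R₂.add (D₂P.mul D₂)).inv
  have B : EntriesMeas _ fun t => S.bB t (P₂ t) := B₁.sub ((B₂.mul N).mul (D₂P.mul D₁))
  have D : EntriesMeas _ fun t => S.bD t (P₂ t) := D₁.sub ((D₂.mul N).mul (D₂P.mul D₁))
  have h0 := (B₂.transpose.mul h₂).add (D₂P.mul C)
  have A₀ : EntriesMeas _ fun t => S.A₀ t (P₂ t) := A.sub ((B₂.mul N).mul h0)
  have C₀ : EntriesMeas _ fun t => S.C₀ t (P₂ t) := C.sub ((D₂.mul N).mul h0)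
  have DP := D.transpose.mul h₁
  have Θ₁ : EntriesMeas _ fun t => S.Θ₁ t (P₁ t) (P₂ t) :=
    ((R₁.add (DP.mul D)).inv.mul ((B.transpose.mul h₁).add (DP.mul C₀))).neg
  have Θ₂ : EntriesMeas _ fun t => S.Θ₂ t (S.Θ₁ t (P₁ t) (P₂ t)) (P₂ t) :=
    (N.mul ((B₂.transpose.mul h₂).add (D₂P.mul (C.add (D₁.mul Θ₁))))).neg
  have bA : EntriesMeas _ fun t => S.bA t (S.Θ₁ t (P₁ t) (P₂ t)) (P₂ t) := A₀.add (B.mul Θ₁)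
  have bC : EntriesMeas _ fun t => S.bC t (S.Θ₁ t (P₁ t) (P₂ t)) (P₂ t) := C₀.add (D.mul Θ₁)
  exact ⟨((((bA.transpose.mul h₁).add (h₁.mul bA)).add ((bC.transpose.mul h₁).mul bC)).add
      Q₁).add ((Θ₁.transpose.mul R₁).mul Θ₁),
    ((((bA.transpose.mul h₂).add (h₂.mul bA)).add ((bC.transpose.mul h₂).mul bC)).add
      Q₂).add ((Θ₂.transpose.mul R₂).mul Θ₂)⟩

end Coefficients

/-! ### Differences and linear images of backward primitives -/

section Abstract

variable {E F : Type*} [NormedAddCommGroup E] [NormedSpace ℝ E] [NormedAddCommGroup F]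
  [NormedSpace ℝ F]

lemma BackwardPrimitive.norm_sub_le_add {τ T B B' : ℝ} {u f v g : ℝ → E}
    (H : BackwardPrimitive τ T u f B) (H' : BackwardPrimitive τ T v g B') {b s t : ℝ}
    (hs : τ ≤ s) (hst : s ≤ t) (ht : t ≤ T) (hb : ∀ᵐ r, r ∈ Set.Ioc s t → ‖f r - g r‖ ≤ b) :
    ‖u s - v s‖ ≤ ‖u t - v t‖ + b * (t - s) := by
  have e : u s - v s = (u t - v t) + ∫ r in s..t, (f r - g r) := by
    rw [intervalIntegral.integral_sub (H.intervalIntegrable hs hst ht)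
      (H'.intervalIntegrable hs hst ht), H.increment hs hst ht, H'.increment hs hst ht]
    abel
  have h1 := intervalIntegral.norm_integral_le_of_norm_le_const_ae (a := s) (b := t)
    (f := fun r => f r - g r) (C := b) (by rwa [Set.uIoc_of_le hst])
  rw [abs_of_nonneg (sub_nonneg.2 hst)] at h1
  rw [e]
  exact (norm_add_le _ _).trans (add_le_add_right h1 _)

lemma BackwardPrimitive.map [CompleteSpace E] [CompleteSpace F] {τ T B : ℝ} {u f : ℝ → E}
    (H : BackwardPrimitive τ T u f B) (φ : E →L[ℝ] F) (hφ : ∀ x, ‖φ x‖ ≤ ‖x‖) :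
    BackwardPrimitive τ T (fun t => φ (u t)) (fun t => φ (f t)) B where
  integrable := φ.integrable_comp H.integrable
  eq t ht := by
    rw [H.eq t ht, map_add, φ.intervalIntegral_comp_comm (H.intervalIntegrable ht.1 ht.2 le_rfl)]
  bound_nonneg := H.bound_nonneg
  bound := H.bound.mono fun s hs => (hφ _).trans hs

end Abstract

/-! ### Lipschitz truncation -/

section Cutoff

variable {E F : Type*} [NormedAddCommGroup E] [NormedAddCommGroup F] [NormedSpace ℝ F]

/-- A Lipschitz cutoff, equal to `1` on the ball of radius `R` and to `0` off the ball of radius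
`R + 1`. -/
noncomputable def cutoff (R : ℝ) (x : E) : ℝ := max 0 (min 1 (R + 1 - ‖x‖))

lemma cutoff_nonneg (R : ℝ) (x : E) : 0 ≤ cutoff R x := le_max_left _ _

lemma cutoff_le_one (R : ℝ) (x : E) : cutoff R x ≤ 1 := max_le zero_le_one (min_le_left _ _)

lemma cutoff_eq_one {R : ℝ} {x : E} (h : ‖x‖ ≤ R) : cutoff R x = 1 := by
  rw [cutoff, min_eq_left (by linarith), max_eq_right zero_le_one]

lemma cutoff_eq_zero {R : ℝ} {x : E} (h : R + 1 < ‖x‖) : cutoff R x = 0 := by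
  rw [cutoff, max_eq_left]
  exact (min_le_right _ _).trans (by linarith)

lemma continuous_cutoff (R : ℝ) : Continuous (cutoff R : E → ℝ) := by
  unfold cutoff; fun_prop

lemma abs_cutoff_sub_le (R : ℝ) (x y : E) : |cutoff R x - cutoff R y| ≤ ‖x - y‖ := by
  have h1 := (abs_max_sub_max_le_abs (min 1 (R + 1 - ‖x‖)) (min 1 (R + 1 - ‖y‖)) 0)
  have h2 := abs_min_sub_min_le_max 1 (R + 1 - ‖x‖) 1 (R + 1 - ‖y‖)
  rw [sub_self, abs_zero, max_eq_right (abs_nonneg _), sub_sub_sub_cancel_left] at h2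
  rw [cutoff, cutoff, max_comm 0, max_comm 0]
  refine h1.trans (h2.trans ?_)
  rw [abs_sub_comm]
  exact abs_norm_sub_norm_le x y

lemma norm_cutoff_smul_le {R c : ℝ} (hc : 0 ≤ c) {C : Set E} {f : E → F}
    (hb : ∀ x ∈ C, ‖x‖ ≤ R + 1 → ‖f x‖ ≤ c) {x : E} (hx : x ∈ C) : ‖cutoff R x • f x‖ ≤ c := by
  rcases le_or_gt ‖x‖ (R + 1) with h | h
  · rw [norm_smul, Real.norm_of_nonneg (cutoff_nonneg R x)]
    have := hb x hx h
    nlinarith [cutoff_nonneg R x, cutoff_le_one R x, norm_nonneg (f x)]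
  · rwa [cutoff_eq_zero h, zero_smul, norm_zero]

/-- The difference is split as `(χ x - χ y) f x + χ y (f x - f y)`, so `f` is estimated only inside
the ball of radius `R + 1`; outside it the cutoff vanishes. Boundedness controls the first part and
the Lipschitz property the second. -/
lemma norm_cutoff_smul_sub_le {R c : ℝ} (hc : 0 ≤ c) {C : Set E} {f : E → F}
    (hb : ∀ x ∈ C, ‖x‖ ≤ R + 1 → ‖f x‖ ≤ c)
    (hl : ∀ x ∈ C, ‖x‖ ≤ R + 1 → ∀ y ∈ C, ‖y‖ ≤ R + 1 → ‖f x - f y‖ ≤ c * ‖x - y‖)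
    {x y : E} (hx : x ∈ C) (hy : y ∈ C) :
    ‖cutoff R x • f x - cutoff R y • f y‖ ≤ 2 * c * ‖x - y‖ := by
  have hlip := abs_cutoff_sub_le R x y
  have hcn : 0 ≤ c * ‖x - y‖ := by positivity
  rcases le_or_gt ‖x‖ (R + 1) with h | h
  · have e : cutoff R x • f x - cutoff R y • f y =
        (cutoff R x - cutoff R y) • f x + cutoff R y • (f x - f y) := by
      rw [sub_smul, smul_sub]; abel
    have h1 : ‖(cutoff R x - cutoff R y) • f x‖ ≤ c * ‖x - y‖ := by
      rw [norm_smul, Real.norm_eq_abs, mul_comm c]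
      exact mul_le_mul hlip (hb x hx h) (norm_nonneg _) (norm_nonneg _)
    have h2 : ‖cutoff R y • (f x - f y)‖ ≤ c * ‖x - y‖ := by
      rcases le_or_gt ‖y‖ (R + 1) with h' | h'
      · rw [norm_smul, Real.norm_of_nonneg (cutoff_nonneg R y)]
        have := hl x hx h y hy h'
        nlinarith [cutoff_nonneg R y, cutoff_le_one R y, norm_nonneg (f x - f y)]
      · rwa [cutoff_eq_zero h', zero_smul, norm_zero]
    rw [e]
    linarith [norm_add_le ((cutoff R x - cutoff R y) • f x) (cutoff R y • (f x - f y))]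
  · rw [cutoff_eq_zero h] at hlip ⊢
    rw [zero_smul, zero_sub, norm_neg]
    rcases le_or_gt ‖y‖ (R + 1) with h' | h'
    · rw [norm_smul, Real.norm_eq_abs]
      rw [zero_sub, abs_neg] at hlip
      have := mul_le_mul hlip (hb y hy h') (norm_nonneg _) (norm_nonneg _)
      linarith
    · rw [cutoff_eq_zero h', zero_smul, norm_zero]; positivity

end Cutoff

/-! ### Invariance of the positive semidefinite cone -/

section Invariance

open scoped Matrix.Norms.Frobenius
open Matrix

variable {n : ℕ}

/-- Invariance of the cone of positive semidefinite matrices under a Carathéodory equation whose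
right-hand side points into the cone up to second order. -/
lemma posSemidef_of_quasi_positive {T B e : ℝ} {X f : ℝ → Matrix (Fin n) (Fin n) ℝ}
    (H : BackwardPrimitive 0 T X f B) (hT : (X T).PosSemidef)
    (hf : ∀ s t, 0 ≤ s → s ≤ t → t ≤ T → ∀ᵐ r, r ∈ Set.Ioc s t →
      (psdProj (X t) + (t - s) • f r +
        (e * (t - s) ^ 2) • (1 : Matrix (Fin n) (Fin n) ℝ)).PosSemidef) :
    ∀ t ∈ Set.Icc 0 T, (X t).PosSemidef := by
  set φ : ℝ → ℝ := fun t => ‖X t - psdProj (X t)‖ with hφ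
  have hφc : ContinuousOn φ (Set.Icc 0 T) := by
    have h1 : Continuous fun M : Matrix (Fin n) (Fin n) ℝ => ‖M - psdProj M‖ :=
      (continuous_id.sub continuous_psdProj).norm
    exact h1.comp_continuousOn H.continuousOn
  -- The distance to the cone grows at most quadratically per step, and it vanishes at `T`; Grönwall
  -- then makes it zero.
  have step : ∀ s t, 0 ≤ s → s ≤ t → t ≤ T → φ s ≤ φ t + (t - s) * (0 * φ t + 0) +
      (|e| * ‖(1 : Matrix (Fin n) (Fin n) ℝ)‖) * (t - s) ^ 2 := by
    intro s t hs hst ht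
    rcases hst.eq_or_lt with rfl | hlt
    · simp
    have hh : 0 < t - s := sub_pos.2 hlt
    set Q := psdProj (X t) with hQ
    have hQs := PSD.transpose_eq (psdProj_posSemidef (X t))
    -- `Y` averages the hypothesis over `r`, since `X s - X t` is the integral of `f`. It lies in
    -- the cone and differs from `X s` by `X t - Q` up to second order, so it is a competitor in the
    -- projection of `X s`.
    set Y := Q + (X s - X t) + (e * (t - s) ^ 2) • (1 : Matrix (Fin n) (Fin n) ℝ) with hY
    have hfs := hf s t hs hst ht
    -- Symmetry of `f r` is extracted from the hypothesis. The inequality for `(i, j)` and `(j, i)`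
    -- together says that the antisymmetric part of `X` is constant.
    have hsym : ∀ i j, X s i j - X s j i ≤ X t i j - X t j i := by
      intro i j
      have := H.functional_le (entryCLM i j - entryCLM j i) (b := 0) hs hst ht (by
        filter_upwards [hfs] with r hr hrm
        have h2 := congrFun (congrFun (PSD.transpose_eq (hr hrm)) i) j
        have h3 := congrFun (congrFun hQs i) j
        simp only [Matrix.transpose_apply, Matrix.add_apply, Matrix.smul_apply, smul_eq_mul,
          Matrix.one_apply, eq_comm (a := j) (b := i)] at h2 h3
        have h4 : (t - s) * (f r i j - f r j i) = 0 := by rw [← hQ] at h2; linarith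
        have h5 := (mul_eq_zero.1 h4).resolve_left hh.ne'
        exact h5.le)
      rw [mul_zero, add_zero] at this
      exact this
    have hquad : ∀ v : Fin n → ℝ, 0 ≤ v ⬝ᵥ (Y *ᵥ v) := by
      intro v
      have htr : ∀ M : Matrix (Fin n) (Fin n) ℝ, (-(vecMulVec v v) * M).trace =
          -(v ⬝ᵥ (M *ᵥ v)) := by
        intro M
        rw [Matrix.neg_mul, Matrix.trace_neg, Matrix.vecMulVec_mul, Matrix.trace_vecMulVec,
          dotProduct_comm, ← Matrix.dotProduct_mulVec]
      have h1 : (-(vecMulVec v v) * X s).trace ≤ (-(vecMulVec v v) * X t).trace + (t - s) *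
          ((t - s)⁻¹ * (v ⬝ᵥ (Q *ᵥ v) + e * (t - s) ^ 2 * (v ⬝ᵥ v))) := by
        refine H.functional_le (traceMul (-(vecMulVec v v))) hs hst ht ?_
        filter_upwards [hfs] with r hr hrm
        change (-(vecMulVec v v) * f r).trace ≤ _
        rw [htr, ← div_eq_inv_mul, le_div_iff₀ hh]
        have := (psd_iff.1 (hr hrm)).2 v
        simp only [Matrix.add_mulVec, Matrix.smul_mulVec, Matrix.one_mulVec, dotProduct_add,
          dotProduct_smul, smul_eq_mul] at this
        linarith
      rw [htr, htr, mul_inv_cancel_left₀ hh.ne'] at h1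
      simp only [hY, Matrix.add_mulVec, Matrix.sub_mulVec, Matrix.smul_mulVec, Matrix.one_mulVec,
        dotProduct_add, dotProduct_sub, dotProduct_smul, smul_eq_mul]
      linarith
    have hYs : Yᵀ = Y := by
      ext i j
      have h3 := congrFun (congrFun hQs i) j
      have h4 := hsym i j
      have h5 := hsym j i
      simp only [Matrix.transpose_apply] at h3
      simp only [hY, Matrix.transpose_apply, Matrix.add_apply, Matrix.sub_apply, Matrix.smul_apply,
        smul_eq_mul, Matrix.one_apply, eq_comm (a := j) (b := i)]
      linarith
    have h6 := norm_sub_psdProj_le (X s) (psd_iff.2 ⟨hYs, hquad⟩)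
    have h7 : X s - Y = (X t - Q) - (e * (t - s) ^ 2) • (1 : Matrix (Fin n) (Fin n) ℝ) := by
      rw [hY]; abel
    rw [h7] at h6
    have h8 := h6.trans (norm_sub_le _ _)
    rw [norm_smul, Real.norm_eq_abs, abs_mul, abs_of_nonneg (sq_nonneg (t - s))] at h8
    simp only [hφ]
    linarith
  intro t ht
  have h9 := backward_gronwall hφc step t ht
  have h0 : φ T = 0 := by simp only [hφ]; rw [psdProj_eq_self hT, sub_self, norm_zero]
  rw [h0, gronwallBound_ε0_δ0] at h9
  have := sub_eq_zero.1 (norm_le_zero_iff.1 h9)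
  rw [this]
  exact psdProj_posSemidef _

/-- A step `h` along `χ F` is a step `h χ` along the Lyapunov field `F`, which stays in the cone up
to second order. The error of replacing `χ F` by `G` and the quadratic term are symmetric of size
`h²`, and a multiple of the identity dominates them. -/
lemma quasi_positive_perturbation {Q X Y Z G : Matrix (Fin n) (Fin n) ℝ} {h χ a b : ℝ}
    (hQ : Q.PosSemidef) (hZ : Z.PosSemidef) (hG : Gᵀ = G) (hh : 0 ≤ h) (hχ : 0 ≤ χ)
    (ha : ‖G - χ • (Xᵀ * Q + Q * X + Yᵀ * Q * Y + Z)‖ ≤ a * h)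
    (hb : ‖χ ^ 2 • (Xᵀ * Q * X)‖ ≤ b) :
    (Q + h • G + (n * (a + b) * h ^ 2) • (1 : Matrix (Fin n) (Fin n) ℝ)).PosSemidef := by
  have h1 := lyapunov_quasi_positive (X := X) (Y := Y) hQ hZ (mul_nonneg hh hχ)
  set F := Xᵀ * Q + Q * X + Yᵀ * Q * Y + Z with hF
  have hFs : Fᵀ = F := by
    have hQs := PSD.transpose_eq hQ
    have hZs := PSD.transpose_eq hZ
    simp only [hF, Matrix.transpose_add, Matrix.transpose_mul, Matrix.transpose_transpose, hQs, hZs,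
      Matrix.mul_assoc]
    abel
  have hXs := PSD.transpose_eq (PSD.conj hQ X)
  set D := h • (G - χ • F) - h ^ 2 • (χ ^ 2 • (Xᵀ * Q * X)) with hD
  have hDs : Dᵀ = D := by
    rw [hD, Matrix.transpose_sub, Matrix.transpose_smul, Matrix.transpose_smul,
      Matrix.transpose_smul, Matrix.transpose_sub, Matrix.transpose_smul, hG, hFs, hXs]
  have hDn : n * ‖D‖ ≤ n * (a + b) * h ^ 2 := by
    have h2 : ‖D‖ ≤ h * (a * h) + h ^ 2 * b := by
      refine (norm_sub_le _ _).trans (add_le_add ?_ ?_)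
      · rw [norm_smul, Real.norm_of_nonneg hh]
        exact mul_le_mul_of_nonneg_left ha hh
      · rw [norm_smul, Real.norm_of_nonneg (sq_nonneg h)]
        exact mul_le_mul_of_nonneg_left hb (sq_nonneg h)
    have := mul_le_mul_of_nonneg_left h2 (Nat.cast_nonneg (α := ℝ) n)
    linarith
  have h3 := h1.add (psd_smul_one_add hDs hDn)
  convert h3 using 1
  rw [hD, smul_sub, smul_smul, smul_smul, mul_pow]
  abel

end Invariance

section Abstract

variable {E F : Type*} [NormedAddCommGroup E] [NormedSpace ℝ E] [NormedAddCommGroup F]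
  [NormedSpace ℝ F] [CompleteSpace E] [CompleteSpace F]

lemma BackwardPrimitive.fst {τ T B : ℝ} {u f : ℝ → E × F} (H : BackwardPrimitive τ T u f B) :
    BackwardPrimitive τ T (fun t => (u t).1) (fun t => (f t).1) B :=
  H.map (ContinuousLinearMap.fst ℝ E F) norm_fst_le

lemma BackwardPrimitive.snd {τ T B : ℝ} {u f : ℝ → E × F} (H : BackwardPrimitive τ T u f B) :
    BackwardPrimitive τ T (fun t => (u t).2) (fun t => (f t).2) B :=
  H.map (ContinuousLinearMap.snd ℝ E F) norm_snd_le

end Abstract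

/-! ### Truncated equation, uniqueness and global existence -/

section WellPosed

open scoped Matrix.Norms.Frobenius
open Matrix

variable {n m₁ m₂ : ℕ}

/-- Componentwise projection onto the positive semidefinite cone. -/
noncomputable def projPair (x : Matrix (Fin n) (Fin n) ℝ × Matrix (Fin n) (Fin n) ℝ) :
    Matrix (Fin n) (Fin n) ℝ × Matrix (Fin n) (Fin n) ℝ := (psdProj x.1, psdProj x.2)

lemma norm_projPair_sub_le (x y : Matrix (Fin n) (Fin n) ℝ × Matrix (Fin n) (Fin n) ℝ) :
    ‖projPair x - projPair y‖ ≤ ‖x - y‖ := by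
  rw [Prod.norm_def, Prod.norm_def]
  exact max_le_max (norm_psdProj_sub_le _ _) (norm_psdProj_sub_le _ _)

/-- The right-hand side of the equilibrium Riccati equation, extended and truncated to a globally
Lipschitz field. -/
noncomputable def truncField (S : LQGame n m₁ m₂) (R t : ℝ)
    (x : Matrix (Fin n) (Fin n) ℝ × Matrix (Fin n) (Fin n) ℝ) :
    Matrix (Fin n) (Fin n) ℝ × Matrix (Fin n) (Fin n) ℝ :=
  cutoff R (projPair x) •
    (S.F₁ t (projPair x).1 (projPair x).2, S.F₂ t (projPair x).1 (projPair x).2)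

lemma exists_truncField_bounds {S : LQGame n m₁ m₂} {c δ : ℝ} (hδ : 0 < δ) (R : ℝ) :
    ∃ b, 0 ≤ b ∧ ∀ t, S.GoodTime c δ t → (∀ x, ‖S.truncField R t x‖ ≤ b) ∧
      ∀ x y, ‖S.truncField R t x - S.truncField R t y‖ ≤ 2 * b * ‖x - y‖ := by
  obtain ⟨b₁, hb₁, H₁⟩ := unifLip_F₁ (S := S) (c := c) (R + 1) hδ
  obtain ⟨b₂, hb₂, H₂⟩ := unifLip_F₂ (S := S) (c := c) (R + 1) hδ
  have hb : 0 ≤ max b₁ b₂ := le_max_of_le_left hb₁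
  refine ⟨max b₁ b₂, hb, fun t ht => ?_⟩
  let f : Matrix (Fin n) (Fin n) ℝ × Matrix (Fin n) (Fin n) ℝ →
    Matrix (Fin n) (Fin n) ℝ × Matrix (Fin n) (Fin n) ℝ :=
    fun y => (S.F₁ t y.1 y.2, S.F₂ t y.1 y.2)
  let Kc : Set (Matrix (Fin n) (Fin n) ℝ × Matrix (Fin n) (Fin n) ℝ) :=
    {y | y.1.PosSemidef ∧ y.2.PosSemidef}
  have hbd : ∀ x ∈ Kc, ‖x‖ ≤ R + 1 → ‖f x‖ ≤ max b₁ b₂ := fun x hx hxR =>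
    max_le_max ((H₁ t ht).1 x ⟨hx.1, hx.2, hxR⟩) ((H₂ t ht).1 x ⟨hx.1, hx.2, hxR⟩)
  have hlip : ∀ x ∈ Kc, ‖x‖ ≤ R + 1 → ∀ y ∈ Kc, ‖y‖ ≤ R + 1 →
      ‖f x - f y‖ ≤ max b₁ b₂ * ‖x - y‖ := by
    intro x hx hxR y hy hyR
    have h1 := (H₁ t ht).2 x ⟨hx.1, hx.2, hxR⟩ y ⟨hy.1, hy.2, hyR⟩
    have h2 := (H₂ t ht).2 x ⟨hx.1, hx.2, hxR⟩ y ⟨hy.1, hy.2, hyR⟩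
    rw [max_mul_of_nonneg _ _ (norm_nonneg _)]
    exact max_le_max h1 h2
  have hmem : ∀ x, projPair x ∈ Kc := fun x => ⟨psdProj_posSemidef _, psdProj_posSemidef _⟩
  refine ⟨fun x => norm_cutoff_smul_le hb hbd (hmem x), fun x y => ?_⟩
  refine (norm_cutoff_smul_sub_le hb hbd hlip (hmem x) (hmem y)).trans ?_
  exact mul_le_mul_of_nonneg_left (norm_projPair_sub_le x y) (by positivity)

/-- The projection `pr` stands for either component, so both equations share one argument. Each is a
Lyapunov operator in its own component with a positive semidefinite source. -/
lemma posSemidef_component {S : LQGame n m₁ m₂} {T c δ R B : ℝ} (hδ : 0 < δ) (hR : 0 ≤ R)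
    (hgood : ∀ᵐ t ∂(volume.restrict (Set.Icc 0 T)), S.GoodTime c δ t)
    {x g : ℝ → Matrix (Fin n) (Fin n) ℝ × Matrix (Fin n) (Fin n) ℝ}
    (H : BackwardPrimitive 0 T x g B)
    (pr : Matrix (Fin n) (Fin n) ℝ × Matrix (Fin n) (Fin n) ℝ → Matrix (Fin n) (Fin n) ℝ)
    (hprn : ∀ y, ‖pr y‖ ≤ ‖y‖) (hproj : ∀ y, pr (projPair y) = psdProj (pr y))
    (Hp : BackwardPrimitive 0 T (fun t => pr (x t)) (fun t => pr (g t)) B)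
    {F : ℝ → Matrix (Fin n) (Fin n) ℝ × Matrix (Fin n) (Fin n) ℝ → Matrix (Fin n) (Fin n) ℝ}
    (hF : UnifLip {t | S.GoodTime c δ t} (psdBall n (R + 1)) F)
    (hform : ∀ t, S.GoodTime c δ t → ∀ y : Matrix (Fin n) (Fin n) ℝ × Matrix (Fin n) (Fin n) ℝ,
      ∃ Z : Matrix (Fin n) (Fin n) ℝ, Z.PosSemidef ∧ F t y =
        (S.bA t (S.Θ₁ t y.1 y.2) y.2)ᵀ * pr y + pr y * S.bA t (S.Θ₁ t y.1 y.2) y.2 +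
          (S.bC t (S.Θ₁ t y.1 y.2) y.2)ᵀ * pr y * S.bC t (S.Θ₁ t y.1 y.2) y.2 + Z)
    (hg : ∀ t, pr (g t) = cutoff R (projPair (x t)) • F t (projPair (x t)))
    (hT : (pr (x T)).PosSemidef) : ∀ t ∈ Set.Icc 0 T, (pr (x t)).PosSemidef := by
  obtain ⟨b, hb, Hb⟩ := hF
  obtain ⟨a, ha, Ha⟩ := unifLip_bA (S := S) (c := c) (R + 1) hδ
  have hB := H.bound_nonneg
  refine posSemidef_of_quasi_positive (e := n * (2 * b * B + a * (R + 1) * a)) Hp hT ?_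
  intro s t hs hst ht
  filter_upwards [ae_Ioc_of_ae_Icc hgood hs ht] with r hr hrm
  have hr := hr hrm
  set y := projPair (x t) with hy
  have hy1 : y.1.PosSemidef := psdProj_posSemidef _
  have hy2 : y.2.PosSemidef := psdProj_posSemidef _
  have hpry : (pr y).PosSemidef := by rw [hy, hproj]; exact psdProj_posSemidef _
  have hsymF : ∀ z : Matrix (Fin n) (Fin n) ℝ × Matrix (Fin n) (Fin n) ℝ,
      (pr z).PosSemidef → (F r z)ᵀ = F r z := by
    intro z hz
    obtain ⟨Z, hZ, hZe⟩ := hform r hr z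
    rw [hZe]
    simp only [Matrix.transpose_add, Matrix.transpose_mul, Matrix.transpose_transpose,
      PSD.transpose_eq hz, PSD.transpose_eq hZ, Matrix.mul_assoc]
    abel
  obtain ⟨Z, hZ, hZe⟩ := hform r hr y
  rw [← hproj, ← hy]
  refine quasi_positive_perturbation (X := S.bA r (S.Θ₁ r y.1 y.2) y.2)
    (Y := S.bC r (S.Θ₁ r y.1 y.2) y.2) (Z := Z) (χ := cutoff R y) hpry hZ ?_
    (sub_nonneg.2 hst) (cutoff_nonneg _ _) ?_ ?_
  · rw [hg, Matrix.transpose_smul, hsymF]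
    rw [hproj]; exact psdProj_posSemidef _
  -- The field along the curve and at the frozen state `y` are compared at the same time `r`. Only
  -- the state moves, by at most `B (t - s)`, so no regularity of the coefficients in time is
  -- needed.
  · rw [← hZe, hg]
    have h1 := norm_cutoff_smul_sub_le (R := R) (f := F r)
      (C := {y : Matrix (Fin n) (Fin n) ℝ × Matrix (Fin n) (Fin n) ℝ |
        y.1.PosSemidef ∧ y.2.PosSemidef}) hb
      (fun z hz hzR => (Hb r hr).1 z ⟨hz.1, hz.2, hzR⟩)
      (fun z hz hzR w hw hwR => (Hb r hr).2 z ⟨hz.1, hz.2, hzR⟩ w ⟨hw.1, hw.2, hwR⟩)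
      (x := projPair (x r)) (y := y) ⟨psdProj_posSemidef _, psdProj_posSemidef _⟩ ⟨hy1, hy2⟩
    refine h1.trans ?_
    have h2 : ‖projPair (x r) - y‖ ≤ B * (t - s) := by
      refine (norm_projPair_sub_le _ _).trans
        ((H.norm_sub_le (hs.trans hrm.1.le) hrm.2 ht).trans ?_)
      exact mul_le_mul_of_nonneg_left (by linarith [hrm.1]) hB
    have := mul_le_mul_of_nonneg_left h2 (show 0 ≤ 2 * b by positivity)
    linarith
  · rcases le_or_gt ‖y‖ (R + 1) with h | h
    · have hX := (Ha r hr).1 y ⟨hy1, hy2, h⟩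
      set X := S.bA r (S.Θ₁ r y.1 y.2) y.2
      have h3 : ‖Xᵀ * pr y * X‖ ≤ a * (R + 1) * a := by
        refine (Matrix.frobenius_norm_mul _ _).trans
          (mul_le_mul ((Matrix.frobenius_norm_mul _ _).trans ?_) hX (norm_nonneg _) (by positivity))
        rw [Matrix.frobenius_norm_transpose]
        exact mul_le_mul hX ((hprn y).trans h) (norm_nonneg _) ha
      rw [norm_smul, Real.norm_of_nonneg (sq_nonneg _)]
      have h4 : cutoff R y ^ 2 ≤ 1 := pow_le_one₀ (cutoff_nonneg _ _) (cutoff_le_one _ _)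
      exact (mul_le_of_le_one_left (norm_nonneg _) h4).trans h3
    · rw [cutoff_eq_zero h]
      simp only [ne_eq, OfNat.ofNat_ne_zero, not_false_eq_true, zero_pow, zero_smul, norm_zero]
      positivity

lemma exists_truncated_solution {S : LQGame n m₁ m₂} {T : ℝ} (hT : 0 < T)
    (hb : S.BoundedCoefficients T) (hp : S.Positivity T) {R : ℝ} (hR : 0 ≤ R) :
    ∃ (x : ℝ → Matrix (Fin n) (Fin n) ℝ × Matrix (Fin n) (Fin n) ℝ) (B : ℝ),
      BackwardPrimitive 0 T x (fun t => S.truncField R t (x t)) B ∧ x T = (S.G₁, S.G₂) ∧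
      ∀ t ∈ Set.Icc 0 T, (x t).1.PosSemidef ∧ (x t).2.PosSemidef := by
  obtain ⟨c, δ, hc, hδ, hgood⟩ := exists_goodTime hb hp
  obtain ⟨b, hb0, hbd⟩ := exists_truncField_bounds (S := S) (c := c) hδ R
  have hmeas : ∀ x : ℝ → Matrix (Fin n) (Fin n) ℝ × Matrix (Fin n) (Fin n) ℝ, Continuous x →
      AEStronglyMeasurable (fun s => S.truncField R s (x s)) (volume.restrict (Set.Icc 0 T)) := by
    intro x hx
    have hp1 : Continuous fun t => psdProj (x t).1 := continuous_psdProj.comp hx.fst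
    have hp2 : Continuous fun t => psdProj (x t).2 := continuous_psdProj.comp hx.snd
    have hm1 : EntriesMeas (volume.restrict (Set.Icc 0 T)) fun t => psdProj (x t).1 := fun i j =>
      (((entryCLM i j).continuous.comp hp1).measurable).aemeasurable
    have hm2 : EntriesMeas (volume.restrict (Set.Icc 0 T)) fun t => psdProj (x t).2 := fun i j =>
      (((entryCLM i j).continuous.comp hp2).measurable).aemeasurable
    have hF := entriesMeas_F hb hm1 hm2
    have hcut : Continuous fun t => cutoff R (projPair (x t)) :=
      (continuous_cutoff R).comp (hp1.prodMk hp2)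
    exact hcut.aestronglyMeasurable.smul
      (hF.1.aestronglyMeasurable.prodMk hF.2.aestronglyMeasurable)
  obtain ⟨x, hx, hint, heq⟩ := exists_caratheodory hT.le (S.truncField R) (S.G₁, S.G₂)
    (show 0 ≤ 2 * b by positivity) hmeas (hgood.mono fun t ht => (hbd t ht).1)
    (hgood.mono fun t ht => (hbd t ht).2)
  have hxT : x T = (S.G₁, S.G₂) := by
    rw [heq T ⟨hT.le, le_rfl⟩, intervalIntegral.integral_same, add_zero]
  have H : BackwardPrimitive 0 T x (fun t => S.truncField R t (x t)) b :=
    ⟨hint, fun t ht => by rw [hxT]; exact heq t ht, hb0, hgood.mono fun t ht => (hbd t ht).1 _⟩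
  refine ⟨x, b, H, hxT, fun t ht => ⟨?_, ?_⟩⟩
  · refine posSemidef_component (F := fun t y => S.F₁ t y.1 y.2) hδ hR hgood H Prod.fst norm_fst_le
      (fun _ => rfl) H.fst (unifLip_F₁ _ hδ) (fun t ht y => ?_) (fun _ => rfl)
      (by rw [hxT]; exact hp.1) t ht
    refine ⟨S.Q₁ t + (S.Θ₁ t y.1 y.2)ᵀ * S.R₁ t * S.Θ₁ t y.1 y.2,
      ht.Q₁_psd.add (PSD.conj (posDef_of_coercive hδ ht.R₁_coercive).posSemidef _), ?_⟩
    rw [← add_assoc]; rfl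
  · refine posSemidef_component (F := fun t y => S.F₂ t y.1 y.2) hδ hR hgood H Prod.snd norm_snd_le
      (fun _ => rfl) H.snd (unifLip_F₂ _ hδ) (fun t ht y => ?_) (fun _ => rfl)
      (by rw [hxT]; exact hp.2.1) t ht
    refine ⟨S.Q₂ t + (S.Θ₂ t (S.Θ₁ t y.1 y.2) y.2)ᵀ * S.R₂ t * S.Θ₂ t (S.Θ₁ t y.1 y.2) y.2,
      ht.Q₂_psd.add (PSD.conj (posDef_of_coercive hδ ht.R₂_coercive).posSemidef _), ?_⟩
    rw [← add_assoc]; rfl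

/-- On `[τ, T]` the curve lies in the cone and in the ball of radius `R`, so both the projection and
the cutoff act as the identity. -/
lemma isERESolution_of_truncated {S : LQGame n m₁ m₂} {T R B τ : ℝ} (hτ : 0 ≤ τ)
    {x : ℝ → Matrix (Fin n) (Fin n) ℝ × Matrix (Fin n) (Fin n) ℝ}
    (H : BackwardPrimitive 0 T x (fun t => S.truncField R t (x t)) B) (hxT : x T = (S.G₁, S.G₂))
    (hpsd : ∀ t ∈ Set.Icc 0 T, (x t).1.PosSemidef ∧ (x t).2.PosSemidef)
    (hR : ∀ t ∈ Set.Icc τ T, ‖x t‖ ≤ R) :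
    S.IsERESolution τ T (fun t => (x t).1) (fun t => (x t).2) := by
  have hsub : Set.Icc τ T ⊆ Set.Icc 0 T := fun t ht => ⟨hτ.trans ht.1, ht.2⟩
  have hfield : ∀ t ∈ Set.Icc τ T, S.truncField R t (x t) =
      (S.F₁ t (x t).1 (x t).2, S.F₂ t (x t).1 (x t).2) := by
    intro t ht
    have hpr : projPair (x t) = x t := Prod.ext (psdProj_eq_self (hpsd t (hsub ht)).1)
      (psdProj_eq_self (hpsd t (hsub ht)).2)
    rw [truncField, hpr, cutoff_eq_one (hR t ht), one_smul]
  have key : ∀ {u g F : ℝ → Matrix (Fin n) (Fin n) ℝ}, BackwardPrimitive 0 T u g B →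
      (∀ t ∈ Set.Icc τ T, g t = F t) →
      (∀ i j, IntegrableOn (fun s => F s i j) (Set.Icc τ T)) ∧
      ∀ t ∈ Set.Icc τ T, ∀ i j, u t i j = u T i j + ∫ s in t..T, F s i j := by
    intro u g F Hu hgF
    refine ⟨fun i j => ?_, fun t ht i j => ?_⟩
    · have h1 : IntegrableOn (fun s => g s i j) (Set.Icc τ T) :=
        IntegrableOn.mono_set ((entryCLM i j).integrable_comp Hu.integrable) hsub
      exact h1.congr_fun (fun s hs => by simp only [hgF s hs]) measurableSet_Icc
    · rw [Hu.eq t (hsub ht), Matrix.add_apply,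
        intervalIntegral_apply Hu.integrable (fun r hr => hsub ⟨ht.1.trans hr.1.le, hr.2⟩) ht.2]
      congr 1
      refine intervalIntegral.integral_congr fun s hs => ?_
      rw [Set.uIcc_of_le ht.2] at hs
      simp only [hgF s ⟨ht.1.trans hs.1, hs.2⟩]
  have k₁ := key H.fst (F := fun t => S.F₁ t (x t).1 (x t).2) fun t ht => by
    simp only [hfield t ht]
  have k₂ := key H.snd (F := fun t => S.F₂ t (x t).1 (x t).2) fun t ht => by
    simp only [hfield t ht]
  exact
    { continuousOn₁ := H.fst.continuousOn.mono hsub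
      continuousOn₂ := H.snd.continuousOn.mono hsub
      posSemidef₁ := fun t ht => (hpsd t (hsub ht)).1
      posSemidef₂ := fun t ht => (hpsd t (hsub ht)).2
      integrable₁ := k₁.1
      integrable₂ := k₂.1
      eq₁ := fun t ht i j => by simpa only [hxT] using k₁.2 t ht i j
      eq₂ := fun t ht i j => by simpa only [hxT] using k₂.2 t ht i j }

lemma IsERESolution.terminal {S : LQGame n m₁ m₂} {τ T : ℝ} (hτT : τ ≤ T)
    {P₁ P₂ : ℝ → Matrix (Fin n) (Fin n) ℝ} (h : S.IsERESolution τ T P₁ P₂) :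
    P₁ T = S.G₁ ∧ P₂ T = S.G₂ := by
  constructor <;> ext i j
  · rw [h.eq₁ T ⟨hτT, le_rfl⟩, intervalIntegral.integral_same, add_zero]
  · rw [h.eq₂ T ⟨hτT, le_rfl⟩, intervalIntegral.integral_same, add_zero]

lemma exists_norm_le_of_continuousOn {k l : ℕ} {a b : ℝ} {M : ℝ → Matrix (Fin k) (Fin l) ℝ}
    (h : ContinuousOn M (Set.Icc a b)) : ∃ r, ∀ t ∈ Set.Icc a b, ‖M t‖ ≤ r := by
  have h1 : ∀ i j, ∃ r, ∀ t ∈ Set.Icc a b, ‖M t i j‖ ≤ r := fun i j =>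
    isCompact_Icc.exists_bound_of_continuousOn (continuousOn_pi.1 (continuousOn_pi.1 h i) j)
  choose r hr using h1
  exact ⟨∑ i, ∑ j, r i j, fun t ht => (norm_le_sum_abs _).trans
    (Finset.sum_le_sum fun i _ => Finset.sum_le_sum fun j _ => hr i j t ht)⟩

lemma backwardPrimitive_of_entries {τ T b : ℝ} {u F : ℝ → Matrix (Fin n) (Fin n) ℝ}
    (hint : ∀ i j, IntegrableOn (fun s => F s i j) (Set.Icc τ T))
    (heq : ∀ t ∈ Set.Icc τ T, ∀ i j, u t i j = u T i j + ∫ s in t..T, F s i j) (hb : 0 ≤ b)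
    (hbd : ∀ᵐ t ∂(volume.restrict (Set.Icc τ T)), ‖F t‖ ≤ b) : BackwardPrimitive τ T u F b := by
  have hBI := bochnerIntegrableOn_of_entries hint
  refine ⟨hBI, fun t ht => ?_, hb, hbd⟩
  ext i j
  rw [heq t ht, Matrix.add_apply,
    intervalIntegral_apply hBI (fun r hr => ⟨ht.1.trans hr.1.le, hr.2⟩) ht.2]

lemma IsERESolution.exists_primitive {S : LQGame n m₁ m₂} {τ T c δ : ℝ} (hτ : 0 ≤ τ) (hτT : τ ≤ T)
    (hδ : 0 < δ) (hgood : ∀ᵐ t ∂(volume.restrict (Set.Icc 0 T)), S.GoodTime c δ t)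
    {P₁ P₂ : ℝ → Matrix (Fin n) (Fin n) ℝ} (h : S.IsERESolution τ T P₁ P₂) :
    ∃ B, BackwardPrimitive τ T P₁ (fun t => S.F₁ t (P₁ t) (P₂ t)) B ∧
      BackwardPrimitive τ T P₂ (fun t => S.F₂ t (P₁ t) (P₂ t)) B := by
  have hsub : Set.Icc τ T ⊆ Set.Icc 0 T := fun t ht => ⟨hτ.trans ht.1, ht.2⟩
  obtain ⟨r₁, hr₁⟩ := exists_norm_le_of_continuousOn h.continuousOn₁
  obtain ⟨r₂, hr₂⟩ := exists_norm_le_of_continuousOn h.continuousOn₂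
  obtain ⟨b₁, hb₁, H₁⟩ := unifLip_F₁ (S := S) (c := c) (max r₁ r₂) hδ
  obtain ⟨b₂, hb₂, H₂⟩ := unifLip_F₂ (S := S) (c := c) (max r₁ r₂) hδ
  have hball : ∀ t ∈ Set.Icc τ T, (P₁ t, P₂ t) ∈ psdBall n (max r₁ r₂) := fun t ht =>
    ⟨h.posSemidef₁ t ht, h.posSemidef₂ t ht, max_le_max (hr₁ t ht) (hr₂ t ht)⟩
  have hgood' := ae_restrict_of_ae_restrict_of_subset hsub hgood
  obtain ⟨hT₁, hT₂⟩ := h.terminal hτT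
  have hbd₁ : ∀ᵐ t ∂(volume.restrict (Set.Icc τ T)), ‖S.F₁ t (P₁ t) (P₂ t)‖ ≤ max b₁ b₂ := by
    filter_upwards [hgood', ae_restrict_mem measurableSet_Icc] with t ht htm
    exact ((H₁ t ht).1 _ (hball t htm)).trans (le_max_left _ _)
  have hbd₂ : ∀ᵐ t ∂(volume.restrict (Set.Icc τ T)), ‖S.F₂ t (P₁ t) (P₂ t)‖ ≤ max b₁ b₂ := by
    filter_upwards [hgood', ae_restrict_mem measurableSet_Icc] with t ht htm
    exact ((H₂ t ht).1 _ (hball t htm)).trans (le_max_right _ _)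
  refine ⟨max b₁ b₂,
    backwardPrimitive_of_entries h.integrable₁ (fun t ht i j => ?_) (le_max_of_le_left hb₁) hbd₁,
    backwardPrimitive_of_entries h.integrable₂ (fun t ht i j => ?_) (le_max_of_le_left hb₁) hbd₂⟩
  · rw [hT₁]; exact h.eq₁ t ht i j
  · rw [hT₂]; exact h.eq₂ t ht i j

lemma IsERESolution.eq_of_bounded {S : LQGame n m₁ m₂} {T c δ K : ℝ} (hT : 0 ≤ T) (hδ : 0 < δ)
    (hgood : ∀ᵐ t ∂(volume.restrict (Set.Icc 0 T)), S.GoodTime c δ t)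
    {P₁ P₂ P₁' P₂' : ℝ → Matrix (Fin n) (Fin n) ℝ} (h : S.IsERESolution 0 T P₁ P₂)
    (h' : S.IsERESolution 0 T P₁' P₂') (hK : ∀ t ∈ Set.Icc 0 T, ‖(P₁ t, P₂ t)‖ ≤ K)
    (hK' : ∀ t ∈ Set.Icc 0 T, ‖(P₁' t, P₂' t)‖ ≤ K) :
    ∀ t ∈ Set.Icc 0 T, P₁' t = P₁ t ∧ P₂' t = P₂ t := by
  obtain ⟨B, H₁, H₂⟩ := h.exists_primitive le_rfl hT hδ hgood
  obtain ⟨B', H₁', H₂'⟩ := h'.exists_primitive le_rfl hT hδ hgood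
  obtain ⟨b₁, hb₁, L₁⟩ := unifLip_F₁ (S := S) (c := c) K hδ
  obtain ⟨b₂, hb₂, L₂⟩ := unifLip_F₂ (S := S) (c := c) K hδ
  have hB := H₁.bound_nonneg
  have hB' := H₁'.bound_nonneg
  set φ : ℝ → ℝ := fun t => ‖P₁' t - P₁ t‖ + ‖P₂' t - P₂ t‖ with hφ
  have hφc : ContinuousOn φ (Set.Icc 0 T) :=
    ((H₁'.continuousOn.sub H₁.continuousOn).norm).add ((H₂'.continuousOn.sub H₂.continuousOn).norm)
  -- Both solutions are Lipschitz in time, so replacing their distance at `r` by that at `t` costs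
  -- only a quadratic error.
  have step : ∀ s t, 0 ≤ s → s ≤ t → t ≤ T → φ s ≤ φ t + (t - s) * ((b₁ + b₂) * φ t + 0) +
      ((b₁ + b₂) * (2 * (B + B'))) * (t - s) ^ 2 := by
    intro s t hs hst ht
    have hh : 0 ≤ t - s := sub_nonneg.2 hst
    have hr : ∀ r ∈ Set.Ioc s t, ‖(P₁' r, P₂' r) - (P₁ r, P₂ r)‖ ≤
        φ t + 2 * (B + B') * (t - s) := by
      intro r hr
      have h0 : ‖(P₁' r, P₂' r) - (P₁ r, P₂ r)‖ ≤ φ r := by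
        rw [Prod.mk_sub_mk, Prod.norm_mk]
        exact max_le (by simp only [hφ]; linarith [norm_nonneg (P₂' r - P₂ r)])
          (by simp only [hφ]; linarith [norm_nonneg (P₁' r - P₁ r)])
      have hr0 := hs.trans hr.1.le
      have inc : ∀ {u v : ℝ → Matrix (Fin n) (Fin n) ℝ} {f g : ℝ → Matrix (Fin n) (Fin n) ℝ},
          BackwardPrimitive 0 T u f B' → BackwardPrimitive 0 T v g B →
          ‖u r - v r‖ ≤ ‖u t - v t‖ + (B + B') * (t - s) := by
        intro u v f g Hu Hv
        have e : u r - v r = (u t - v t) + ((u r - u t) - (v r - v t)) := by abel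
        rw [e]
        refine (norm_add_le _ _).trans (add_le_add_right ((norm_sub_le _ _).trans ?_) _)
        have h1 := Hu.norm_sub_le hr0 hr.2 ht
        have h2 := Hv.norm_sub_le hr0 hr.2 ht
        have h3 := mul_le_mul_of_nonneg_left (show t - r ≤ t - s by linarith [hr.1]) hB
        have h4 := mul_le_mul_of_nonneg_left (show t - r ≤ t - s by linarith [hr.1]) hB'
        linarith
      have i1 := inc H₁' H₁
      have i2 := inc H₂' H₂
      have : φ r ≤ φ t + 2 * (B + B') * (t - s) := by simp only [hφ]; linarith
      exact h0.trans this
    have hball : ∀ r ∈ Set.Ioc s t, (P₁ r, P₂ r) ∈ psdBall n K := fun r hr =>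
      have hm : r ∈ Set.Icc 0 T := ⟨hs.trans hr.1.le, hr.2.trans ht⟩
      ⟨h.posSemidef₁ r hm, h.posSemidef₂ r hm, hK r hm⟩
    have hball' : ∀ r ∈ Set.Ioc s t, (P₁' r, P₂' r) ∈ psdBall n K := fun r hr =>
      have hm : r ∈ Set.Icc 0 T := ⟨hs.trans hr.1.le, hr.2.trans ht⟩
      ⟨h'.posSemidef₁ r hm, h'.posSemidef₂ r hm, hK' r hm⟩
    have e1 := H₁'.norm_sub_le_add H₁ (b := b₁ * (φ t + 2 * (B + B') * (t - s))) hs hst ht (by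
      filter_upwards [ae_Ioc_of_ae_Icc hgood hs ht] with r hg hrm
      exact ((L₁ r (hg hrm)).2 _ (hball' r hrm) _ (hball r hrm)).trans
        (mul_le_mul_of_nonneg_left (hr r hrm) hb₁))
    have e2 := H₂'.norm_sub_le_add H₂ (b := b₂ * (φ t + 2 * (B + B') * (t - s))) hs hst ht (by
      filter_upwards [ae_Ioc_of_ae_Icc hgood hs ht] with r hg hrm
      exact ((L₂ r (hg hrm)).2 _ (hball' r hrm) _ (hball r hrm)).trans
        (mul_le_mul_of_nonneg_left (hr r hrm) hb₂))
    have : φ t = ‖P₁' t - P₁ t‖ + ‖P₂' t - P₂ t‖ := rfl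
    have : φ s = ‖P₁' s - P₁ s‖ + ‖P₂' s - P₂ s‖ := rfl
    linarith
  intro t ht
  have h9 := backward_gronwall hφc step t ht
  have h0 : φ T = 0 := by
    simp only [hφ]
    rw [(h.terminal hT).1, (h.terminal hT).2, (h'.terminal hT).1, (h'.terminal hT).2]
    simp
  rw [h0, gronwallBound_ε0_δ0] at h9
  have p1 := norm_nonneg (P₁' t - P₁ t)
  have p2 := norm_nonneg (P₂' t - P₂ t)
  simp only [hφ] at h9
  exact ⟨sub_eq_zero.1 (norm_le_zero_iff.1 (by linarith)),
    sub_eq_zero.1 (norm_le_zero_iff.1 (by linarith))⟩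

/-- An a priori estimate implies global well-posedness of the equilibrium Riccati equation. -/
theorem globallyWellPosed_of_aprioriEstimate {S : LQGame n m₁ m₂} {T : ℝ} (hT : 0 < T)
    (hb : S.BoundedCoefficients T) (hp : S.Positivity T) (ha : S.AprioriEstimate T) :
    S.GloballyWellPosed T := by
  obtain ⟨K, hK⟩ := ha
  set R := max K ‖(S.G₁, S.G₂)‖ + 1 with hR
  have hG0 := norm_nonneg (S.G₁, S.G₂)
  have hKR : K < R := (le_max_left K ‖(S.G₁, S.G₂)‖).trans_lt (lt_add_one _)
  have hGR : ‖(S.G₁, S.G₂)‖ < R := (le_max_right K ‖(S.G₁, S.G₂)‖).trans_lt (lt_add_one _)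
  obtain ⟨x, B, H, hxT, hpsd⟩ := exists_truncated_solution hT hb hp (hG0.trans hGR.le)
  have hnc : ContinuousOn (fun t => ‖x t‖) (Set.Icc 0 T) := H.continuousOn.norm
  have hxR : ∀ t ∈ Set.Icc 0 T, ‖x t‖ < R := by
    by_contra! hcon
    obtain ⟨t₀, ht₀, hxt₀⟩ := hcon
    -- `τ` is the last time at which the norm is at least `R`. On `[τ, T]` the truncation is
    -- inactive, so the a priori estimate on that subinterval bounds the norm at `τ` by `K < R`, a
    -- contradiction.
    set A : Set ℝ := Set.Icc 0 T ∩ (fun t => ‖x t‖) ⁻¹' Set.Ici R with hA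
    have hAc : IsCompact A :=
      isCompact_Icc.of_isClosed_subset (hnc.preimage_isClosed_of_isClosed isClosed_Icc isClosed_Ici)
        Set.inter_subset_left
    have hAm := hAc.sSup_mem ⟨t₀, ht₀, hxt₀⟩
    set τ := sSup A with hτ
    have hτT : τ < T := by
      refine lt_of_le_of_ne hAm.1.2 fun h => ?_
      have := hAm.2
      rw [h, Set.mem_preimage, Set.mem_Ici, hxT] at this
      linarith
    have hlt : ∀ t, τ < t → t ≤ T → ‖x t‖ < R := by
      intro t ht htT
      by_contra! h
      exact absurd (le_csSup hAc.bddAbove ⟨⟨hAm.1.1.trans ht.le, htT⟩, h⟩) (not_le.2 ht)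
    have hτR : ‖x τ‖ ≤ R := by
      have h1 : Filter.Tendsto (fun t => ‖x t‖) (nhdsWithin τ (Set.Ioc τ T)) (nhds ‖x τ‖) :=
        (hnc τ hAm.1).mono_left (nhdsWithin_mono _ fun r hr => ⟨hAm.1.1.trans hr.1.le, hr.2⟩)
      have : (nhdsWithin τ (Set.Ioc τ T)).NeBot := by
        rw [nhdsWithin_Ioc_eq_nhdsGT hτT]; infer_instance
      refine le_of_tendsto h1 ?_
      filter_upwards [self_mem_nhdsWithin] with r hr
      exact (hlt r hr.1 hr.2).le
    have hsol := isERESolution_of_truncated hAm.1.1 H hxT hpsd (τ := τ) fun t ht => by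
      rcases ht.1.eq_or_lt with rfl | h
      · exact hτR
      · exact (hlt t h ht.2).le
    have h2 := hK τ hAm.1.1 hτT _ _ hsol τ ⟨le_rfl, hτT.le⟩
    have h3 := (norm_prod_le_vecNorm (x τ).1 (x τ).2).trans h2
    have h4 : R ≤ ‖x τ‖ := hAm.2
    exact absurd (h4.trans h3) (not_le.2 hKR)
  have hsol := isERESolution_of_truncated le_rfl H hxT hpsd (τ := 0) fun t ht => (hxR t ht).le
  obtain ⟨c, δ, hc, hδ, hgood⟩ := exists_goodTime hb hp
  refine ⟨_, _, hsol, fun P₁' P₂' hsol' => hsol.eq_of_bounded hT.le hδ hgood hsol' (K := K)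
    (fun t ht => ?_) fun t ht => ?_⟩
  · exact (norm_prod_le_vecNorm _ _).trans (hK 0 le_rfl hT _ _ hsol t ht)
  · exact (norm_prod_le_vecNorm _ _).trans (hK 0 le_rfl hT _ _ hsol' t ht)

end WellPosed

/-! ### A priori estimate from a Lyapunov weight -/

section Apriori

open scoped Matrix.Norms.Frobenius
open Matrix

variable {n m₁ m₂ : ℕ}

lemma norm_lyapunov_le (A C P : Matrix (Fin n) (Fin n) ℝ) {a b : ℝ} (hA : ‖A‖ ≤ a) (hC : ‖C‖ ≤ b) :
    ‖Aᵀ * P + P * A + Cᵀ * P * C‖ ≤ (2 * a + b * b) * ‖P‖ := by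
  have ha := (norm_nonneg A).trans hA
  have hb := (norm_nonneg C).trans hC
  have h1 : ‖Aᵀ * P‖ ≤ a * ‖P‖ := (Matrix.frobenius_norm_mul _ _).trans
    (mul_le_mul_of_nonneg_right (by rwa [Matrix.frobenius_norm_transpose]) (norm_nonneg _))
  have h2 : ‖P * A‖ ≤ ‖P‖ * a := (Matrix.frobenius_norm_mul _ _).trans
    (mul_le_mul_of_nonneg_left hA (norm_nonneg _))
  have h3 : ‖Cᵀ * P * C‖ ≤ b * ‖P‖ * b := by
    refine (Matrix.frobenius_norm_mul _ _).trans
      (mul_le_mul ((Matrix.frobenius_norm_mul _ _).trans ?_) hC (norm_nonneg _) (by positivity))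
    exact mul_le_mul_of_nonneg_right (by rwa [Matrix.frobenius_norm_transpose]) (norm_nonneg _)
  linarith [norm_add_le (Aᵀ * P + P * A) (Cᵀ * P * C), norm_add_le (Aᵀ * P) (P * A)]

lemma norm_Θ₁_le {S : LQGame n m₁ m₂} {c δ t a : ℝ} (hδ : 0 < δ) (hg : S.GoodTime c δ t)
    {P₁ P₂ : Matrix (Fin n) (Fin n) ℝ} (h₁ : P₁.PosSemidef) (hB : ‖S.bB t P₂‖ ≤ a)
    (hD : ‖S.bD t P₂‖ ≤ a) (hC : ‖S.C₀ t P₂‖ ≤ a) {κ : ℝ} (hκ : ‖P₁‖ ≤ κ) :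
    ‖S.Θ₁ t P₁ P₂‖ ≤ m₁ * (m₁ * δ⁻¹) * (a * κ + a * κ * a) := by
  have ha := (norm_nonneg _).trans hB
  have hκ0 := (norm_nonneg _).trans hκ
  have hinv := norm_inv_le_of_coercive hδ
    (coercive_add hg.R₁_coercive (PSD.conj h₁ (S.bD t P₂)))
  have hBP : ‖(S.bB t P₂)ᵀ * P₁‖ ≤ a * κ := (Matrix.frobenius_norm_mul _ _).trans
    (mul_le_mul (by rwa [Matrix.frobenius_norm_transpose]) hκ (norm_nonneg _) ha)
  have hDP : ‖(S.bD t P₂)ᵀ * P₁‖ ≤ a * κ := (Matrix.frobenius_norm_mul _ _).trans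
    (mul_le_mul (by rwa [Matrix.frobenius_norm_transpose]) hκ (norm_nonneg _) ha)
  have hDPC : ‖(S.bD t P₂)ᵀ * P₁ * S.C₀ t P₂‖ ≤ a * κ * a := (Matrix.frobenius_norm_mul _ _).trans
    (mul_le_mul hDP hC (norm_nonneg _) (by positivity))
  change ‖-((S.R₁ t + (S.bD t P₂)ᵀ * P₁ * S.bD t P₂)⁻¹ *
    ((S.bB t P₂)ᵀ * P₁ + (S.bD t P₂)ᵀ * P₁ * S.C₀ t P₂))‖ ≤ _
  rw [norm_neg]
  exact (Matrix.frobenius_norm_mul _ _).trans (mul_le_mul hinv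
    ((norm_add_le _ _).trans (add_le_add hBP hDPC)) (norm_nonneg _) (by positivity))

/-- The a priori estimate follows from a Lyapunov weight `W` under which the drift of the
`P₁`-equation grows at most linearly, provided that the coefficients of the leader's problem are
bounded uniformly in `P₂`. -/
theorem aprioriEstimate_of_weight {S : LQGame n m₁ m₂} {T c δ : ℝ} (hT : 0 < T) (hδ : 0 < δ)
    (hc : 0 ≤ c) (hgood : ∀ᵐ t ∂(volume.restrict (Set.Icc 0 T)), S.GoodTime c δ t)
    {W : ℝ → Matrix (Fin n) (Fin n) ℝ} {w L a : ℝ} (hw : 0 < w) (hL : 0 ≤ L) (ha : 0 ≤ a)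
    (hW : ∀ t ∈ Set.Icc 0 T, (W t - w • (1 : Matrix (Fin n) (Fin n) ℝ)).PosSemidef)
    (hWL : ∀ s ∈ Set.Icc 0 T, ∀ t ∈ Set.Icc 0 T, ‖W s - W t‖ ≤ L * |s - t|)
    (hcoef : ∀ᵐ t ∂(volume.restrict (Set.Icc 0 T)), ∀ P₂ : Matrix (Fin n) (Fin n) ℝ,
      P₂.PosSemidef → ‖S.bB t P₂‖ ≤ a ∧ ‖S.bD t P₂‖ ≤ a ∧ ‖S.C₀ t P₂‖ ≤ a)
    (hdrift : ∀ᵐ t ∂(volume.restrict (Set.Icc 0 T)), ∀ P₁ P₂ : Matrix (Fin n) (Fin n) ℝ,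
      P₁.PosSemidef → P₂.PosSemidef →
      (W t * ((S.A₀ t P₂)ᵀ * P₁ + P₁ * S.A₀ t P₂)).trace ≤ a * P₁.trace) :
    S.AprioriEstimate T := by
  have hn : (0 : ℝ) ≤ n := Nat.cast_nonneg n
  set ω := ‖W T‖ + L * T with hω
  have hω0 : 0 ≤ ω := by positivity
  have hWω : ∀ t ∈ Set.Icc 0 T, ‖W t‖ ≤ ω := by
    intro t ht
    have h1 := hWL t ht T ⟨hT.le, le_rfl⟩
    have h2 : L * |t - T| ≤ L * T := mul_le_mul_of_nonneg_left (by
      rw [abs_sub_comm, abs_of_nonneg (sub_nonneg.2 ht.2)]; linarith [ht.1]) hL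
    have h3 := norm_add_le (W T) (W t - W T)
    rw [add_sub_cancel] at h3
    linarith
  set c₁ := a + n * (ω * (a * a * (n * n))) + n * (ω * c) with hc₁
  set K₁ := w⁻¹ * gronwallBound (W T * S.G₁).trace ((c₁ + n * (n * n) * L) * w⁻¹) c₁ T with hK₁
  -- The absolute value provides `κ ≥ 0` even before any solution is known to exist.
  set κ := n * (n * |K₁|) with hκ
  set ϑ := m₁ * (m₁ * δ⁻¹) * (a * κ + a * κ * a) with hϑ
  have hκ0 : 0 ≤ κ := by positivity
  have hϑ0 : 0 ≤ ϑ := by positivity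
  set e := 2 * (c + c * ϑ) + (c + c * ϑ) * (c + c * ϑ) with he
  have he0 : 0 ≤ e := by positivity
  set c₂ := n * (e * (n * n)) + n * c with hc₂
  have hc₁0 : 0 ≤ c₁ := by positivity
  have hc₂0 : 0 ≤ c₂ := by positivity
  -- The trivial factors are those of `trace_bound` for the constant weight `1` with `L = 0`.
  set K₂ := (1 : ℝ)⁻¹ * gronwallBound (1 * S.G₂).trace ((c₂ + n * (n * n) * 0) * (1 : ℝ)⁻¹) c₂ T
  refine ⟨κ + n * (n * K₂), fun τ hτ hτT P₁ P₂ h => ?_⟩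
  obtain ⟨B, H₁, H₂⟩ := h.exists_primitive hτ hτT.le hδ hgood
  obtain ⟨hT₁, hT₂⟩ := h.terminal hτT.le
  have hsub : Set.Icc τ T ⊆ Set.Icc 0 T := fun t ht => ⟨hτ.trans ht.1, ht.2⟩
  have hgood' := ae_restrict_of_ae_restrict_of_subset hsub hgood
  have hcoef' := ae_restrict_of_ae_restrict_of_subset hsub hcoef
  have hdrift' := ae_restrict_of_ae_restrict_of_subset hsub hdrift
  have htr₁ : ∀ t ∈ Set.Icc τ T, (P₁ t).trace ≤ K₁ := by
    have := trace_bound H₁ hτ h.posSemidef₁ hw hL hc₁0 hW hWL (by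
      filter_upwards [hgood', hcoef', hdrift', ae_restrict_mem measurableSet_Icc] with t hg hco hdr
        htm
      have hp₁ := h.posSemidef₁ t htm
      have hp₂ := h.posSemidef₂ t htm
      obtain ⟨-, -, hC⟩ := hco _ hp₂
      have hWp : (W t).PosSemidef := (posDef_of_coercive hw (hW t (hsub htm))).posSemidef
      have hWt := hWω t (hsub htm)
      have hK := coercive_add hg.R₁_coercive (PSD.conj hp₁ (S.bD t (P₂ t)))
      -- The weighted trace of the completed square is nonnegative, so its contribution to the
      -- derivative bound can be dropped.
      have h1 := PSD.trace_mul_nonneg hWp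
        (PSD.conj (posDef_of_coercive hδ hK).posSemidef (S.Θ₁ t (P₁ t) (P₂ t)))
      have h2 := hdr _ _ hp₁ hp₂
      have htr := hp₁.trace_nonneg
      have hPn := PSD.norm_le_trace hp₁
      have h3 : (W t * ((S.C₀ t (P₂ t))ᵀ * P₁ t * S.C₀ t (P₂ t))).trace ≤
          n * (ω * (a * a * (n * (n * (P₁ t).trace)))) := by
        refine (trace_mul_le _ _).trans (mul_le_mul_of_nonneg_left ?_ hn)
        refine mul_le_mul hWt ?_ (norm_nonneg _) hω0
        have := norm_lyapunov_le 0 (S.C₀ t (P₂ t)) (P₁ t) (a := 0) (by simp) hC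
        rw [Matrix.transpose_zero, zero_mul, mul_zero, zero_add, zero_add, mul_zero, zero_add]
          at this
        exact this.trans (mul_le_mul_of_nonneg_left hPn (by positivity))
      have h4 : (W t * S.Q₁ t).trace ≤ n * (ω * c) :=
        (trace_mul_le _ _).trans (mul_le_mul_of_nonneg_left
          (mul_le_mul hWt hg.Q₁ (norm_nonneg _) hω0) hn)
      rw [F₁_eq hδ hg hp₁]
      simp only [mul_sub, mul_add, Matrix.trace_sub, Matrix.trace_add] at h2 ⊢
      have h5 : 0 ≤ (n * (ω * c)) * (P₁ t).trace := by positivity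
      have h6 : 0 ≤ n * (ω * (a * a * (n * n))) := by positivity
      rw [hc₁]
      linarith)
    rwa [hT₁] at this
  have hP₁ : ∀ t ∈ Set.Icc τ T, ‖P₁ t‖ ≤ κ := fun t ht =>
    (PSD.norm_le_trace (h.posSemidef₁ t ht)).trans (mul_le_mul_of_nonneg_left
      (mul_le_mul_of_nonneg_left ((htr₁ t ht).trans (le_abs_self K₁)) hn) hn)
  have htr₂ : ∀ t ∈ Set.Icc τ T, (P₂ t).trace ≤ K₂ := by
    have := trace_bound H₂ hτ h.posSemidef₂ (W := fun _ => 1) one_pos le_rfl hc₂0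
      (fun t _ => by rw [one_smul, sub_self]; exact Matrix.PosSemidef.zero)
      (fun s _ t _ => by simp) (by
      filter_upwards [hgood', hcoef', ae_restrict_mem measurableSet_Icc] with t hg hco htm
      have hp₁ := h.posSemidef₁ t htm
      have hp₂ := h.posSemidef₂ t htm
      obtain ⟨hB, hD, hC⟩ := hco _ hp₂
      have hΘ := norm_Θ₁_le hδ hg hp₁ hB hD hC (hP₁ t htm)
      have hK := coercive_add hg.R₂_coercive (PSD.conj hp₂ (S.D₂ t))
      have h1 := (PSD.conj (posDef_of_coercive hδ hK).posSemidef
        (S.Θ₂ t (S.Θ₁ t (P₁ t) (P₂ t)) (P₂ t))).trace_nonneg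
      have hPn := PSD.norm_le_trace hp₂
      have htr := hp₂.trace_nonneg
      have hA' : ‖S.A t + S.B₁ t * S.Θ₁ t (P₁ t) (P₂ t)‖ ≤ c + c * ϑ :=
        (norm_add_le _ _).trans (add_le_add hg.A ((Matrix.frobenius_norm_mul _ _).trans
          (mul_le_mul hg.B₁ hΘ (norm_nonneg _) hc)))
      have hC' : ‖S.C t + S.D₁ t * S.Θ₁ t (P₁ t) (P₂ t)‖ ≤ c + c * ϑ :=
        (norm_add_le _ _).trans (add_le_add hg.C ((Matrix.frobenius_norm_mul _ _).trans
          (mul_le_mul hg.D₁ hΘ (norm_nonneg _) hc)))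
      have h2 := (trace_le _).trans (mul_le_mul_of_nonneg_left
        ((norm_lyapunov_le _ _ (P₂ t) hA' hC').trans (mul_le_mul_of_nonneg_left hPn he0)) hn)
      have h3 := (trace_le (S.Q₂ t)).trans (mul_le_mul_of_nonneg_left hg.Q₂ hn)
      rw [one_mul, F₂_eq hδ hg hp₂, Matrix.trace_sub, Matrix.trace_add]
      have h4 : 0 ≤ n * (e * (n * n)) := by positivity
      have h5 : 0 ≤ n * c * (P₂ t).trace := by positivity
      rw [hc₂]
      linarith)
    rwa [hT₂] at this
  intro s hs
  refine (vecNorm_le _ _).trans (add_le_add (hP₁ s hs) ?_)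
  refine (PSD.norm_le_trace (h.posSemidef₂ s hs)).trans ?_
  have := htr₂ s hs
  gcongr

end Apriori

/-! ### The three structural cases -/

section Cases

open scoped Matrix.Norms.Frobenius
open Matrix

variable {n m₁ m₂ : ℕ}

/-- The a priori estimate when the follower's gain `(R₂ + D₂ᵀ P₂ D₂)⁻¹` decays like `‖P₂‖⁻¹`. -/
lemma aprioriEstimate_of_decay {S : LQGame n m₁ m₂} {T c δ ν : ℝ} (hT : 0 < T) (hδ : 0 < δ)
    (hc : 0 ≤ c) (hgood : ∀ᵐ t ∂(volume.restrict (Set.Icc 0 T)), S.GoodTime c δ t) (hν : 0 ≤ ν)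
    (hdecay : ∀ᵐ t ∂(volume.restrict (Set.Icc 0 T)), ∀ P₂ : Matrix (Fin n) (Fin n) ℝ,
      P₂.PosSemidef → ‖S.N₂ t P₂‖ * ‖P₂‖ ≤ ν) : S.AprioriEstimate T := by
  set a := c + c * ν * (c * c) + c * ν * (c + c * c) with ha
  have ha0 : 0 ≤ a := by positivity
  have h0 : 0 ≤ c * ν * (c * c) := by positivity
  have h0' : 0 ≤ c * ν * (c + c * c) := by positivity
  -- Every `P₂`-dependent correction has the form `X N Z` with `Z` linear in `P₂`; the decay of `N`
  -- cancels that growth.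
  have gain : ∀ {l : ℕ} {X : Matrix (Fin n) (Fin m₂) ℝ} {N : Matrix (Fin m₂) (Fin m₂) ℝ}
      {P : Matrix (Fin n) (Fin n) ℝ} {Z : Matrix (Fin m₂) (Fin l) ℝ}
      {y : ℝ}, 0 ≤ y → ‖X‖ ≤ c → ‖N‖ * ‖P‖ ≤ ν → ‖Z‖ ≤ ‖P‖ * y →
      ‖X * N * Z‖ ≤ c * ν * y := by
    intro l X N P Z y hy hX hN hZ
    refine (Matrix.frobenius_norm_mul _ _).trans ?_
    calc ‖X * N‖ * ‖Z‖ ≤ (‖X‖ * ‖N‖) * (‖P‖ * y) :=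
          mul_le_mul (Matrix.frobenius_norm_mul _ _) hZ (norm_nonneg _) (by positivity)
      _ = ‖X‖ * (‖N‖ * ‖P‖) * y := by ring
      _ ≤ c * ν * y := mul_le_mul_of_nonneg_right
          (mul_le_mul hX hN (by positivity) hc) hy
  have hall : ∀ᵐ t ∂(volume.restrict (Set.Icc 0 T)), ∀ P₂ : Matrix (Fin n) (Fin n) ℝ,
      P₂.PosSemidef → ‖S.bB t P₂‖ ≤ a ∧ ‖S.bD t P₂‖ ≤ a ∧ ‖S.C₀ t P₂‖ ≤ a ∧ ‖S.A₀ t P₂‖ ≤ a := by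
    filter_upwards [hgood, hdecay] with t hg hd P hP
    have hN := hd P hP
    have hDP : ‖(S.D₂ t)ᵀ * P‖ ≤ c * ‖P‖ := (Matrix.frobenius_norm_mul _ _).trans
      (mul_le_mul_of_nonneg_right (by rw [Matrix.frobenius_norm_transpose]; exact hg.D₂)
        (norm_nonneg _))
    have hBP : ‖(S.B₂ t)ᵀ * P‖ ≤ c * ‖P‖ := (Matrix.frobenius_norm_mul _ _).trans
      (mul_le_mul_of_nonneg_right (by rw [Matrix.frobenius_norm_transpose]; exact hg.B₂)
        (norm_nonneg _))
    have hDPD : ‖(S.D₂ t)ᵀ * P * S.D₁ t‖ ≤ ‖P‖ * (c * c) := by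
      refine (Matrix.frobenius_norm_mul _ _).trans ?_
      have := mul_le_mul hDP hg.D₁ (norm_nonneg _) (by positivity)
      linarith
    have hsum : ‖(S.B₂ t)ᵀ * P + (S.D₂ t)ᵀ * P * S.C t‖ ≤ ‖P‖ * (c + c * c) := by
      have h1 : ‖(S.D₂ t)ᵀ * P * S.C t‖ ≤ c * ‖P‖ * c := (Matrix.frobenius_norm_mul _ _).trans
        (mul_le_mul hDP hg.C (norm_nonneg _) (by positivity))
      linarith [norm_add_le ((S.B₂ t)ᵀ * P) ((S.D₂ t)ᵀ * P * S.C t)]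
    have hcc : 0 ≤ c * c := by positivity
    have hcc' : 0 ≤ c + c * c := by positivity
    refine ⟨?_, ?_, ?_, ?_⟩
    · have := gain hcc hg.B₂ hN hDPD
      have := norm_sub_le (S.B₁ t) (S.B₂ t * S.N₂ t P * ((S.D₂ t)ᵀ * P * S.D₁ t))
      have := hg.B₁
      rw [bB]; linarith
    · have := gain hcc hg.D₂ hN hDPD
      have := norm_sub_le (S.D₁ t) (S.D₂ t * S.N₂ t P * ((S.D₂ t)ᵀ * P * S.D₁ t))
      have := hg.D₁
      rw [bD]; linarith
    · have := gain hcc' hg.D₂ hN hsum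
      have := norm_sub_le (S.C t) (S.D₂ t * S.N₂ t P * ((S.B₂ t)ᵀ * P + (S.D₂ t)ᵀ * P * S.C t))
      have := hg.C
      rw [C₀]; linarith
    · have := gain hcc' hg.B₂ hN hsum
      have := norm_sub_le (S.A t) (S.B₂ t * S.N₂ t P * ((S.B₂ t)ᵀ * P + (S.D₂ t)ᵀ * P * S.C t))
      have := hg.A
      rw [A₀]; linarith
  have hn : (0 : ℝ) ≤ n := Nat.cast_nonneg n
  refine aprioriEstimate_of_weight (W := fun _ => 1) (w := 1) (L := 0)
    (a := a + n * (2 * a * (n * n))) hT hδ hc hgood one_pos le_rfl (by positivity)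
    (fun t _ => by rw [one_smul, sub_self]; exact Matrix.PosSemidef.zero) (fun s _ t _ => by simp)
    ?_ ?_
  · filter_upwards [hall] with t ht P hP
    obtain ⟨h1, h2, h3, -⟩ := ht P hP
    have : 0 ≤ n * (2 * a * (n * n)) := by positivity
    exact ⟨by linarith, by linarith, by linarith⟩
  · filter_upwards [hall] with t ht P₁ P₂ hP₁ hP₂
    obtain ⟨-, -, -, hA⟩ := ht P₂ hP₂
    have h1 := norm_lyapunov_le (S.A₀ t P₂) 0 P₁ (b := 0) hA (by simp)
    rw [mul_zero, mul_zero, add_zero, add_zero] at h1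
    have h2 := (trace_le _).trans (mul_le_mul_of_nonneg_left
      (h1.trans (mul_le_mul_of_nonneg_left (PSD.norm_le_trace hP₁)
        (show 0 ≤ 2 * a by positivity))) hn)
    have h3 := mul_nonneg ha0 hP₁.trace_nonneg
    rw [one_mul]
    linarith

/-- The a priori estimate when the follower does not act on the diffusion, for a weight compatible
with the follower's feedback matrix `B₂ R₂⁻¹ B₂ᵀ`. -/
lemma aprioriEstimate_of_D₂_eq_zero {S : LQGame n m₁ m₂} {T c δ : ℝ} (hT : 0 < T) (hδ : 0 < δ)
    (hc : 0 ≤ c) (hgood : ∀ᵐ t ∂(volume.restrict (Set.Icc 0 T)), S.GoodTime c δ t)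
    (hD : ∀ᵐ t ∂(volume.restrict (Set.Icc 0 T)), S.D₂ t = 0)
    {W : ℝ → Matrix (Fin n) (Fin n) ℝ} {w L ω : ℝ} (hw : 0 < w) (hL : 0 ≤ L) (hω : 0 ≤ ω)
    (hW : ∀ t ∈ Set.Icc 0 T, (W t - w • (1 : Matrix (Fin n) (Fin n) ℝ)).PosSemidef)
    (hWL : ∀ s ∈ Set.Icc 0 T, ∀ t ∈ Set.Icc 0 T, ‖W s - W t‖ ≤ L * |s - t|)
    (hWω : ∀ t ∈ Set.Icc 0 T, ‖W t‖ ≤ ω)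
    (hcomp : ∀ᵐ t ∂(volume.restrict (Set.Icc 0 T)), ∀ P₁ P₂ : Matrix (Fin n) (Fin n) ℝ,
      P₁.PosSemidef → P₂.PosSemidef →
      0 ≤ (W t * (P₂ * (S.B₂ t * (S.R₂ t)⁻¹ * (S.B₂ t)ᵀ) * P₁)).trace ∧
      0 ≤ (W t * (P₁ * (S.B₂ t * (S.R₂ t)⁻¹ * (S.B₂ t)ᵀ) * P₂)).trace) :
    S.AprioriEstimate T := by
  have hn : (0 : ℝ) ≤ n := Nat.cast_nonneg n
  set a' := n * (ω * (2 * c * (n * n))) with ha'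
  have ha'0 : 0 ≤ a' := by positivity
  refine aprioriEstimate_of_weight (W := W) (a := c + a') hT hδ hc hgood hw hL (by positivity)
    hW hWL ?_ ?_
  · filter_upwards [hgood, hD] with t hg hd P _
    have h1 := hg.B₁
    have h2 := hg.D₁
    have h3 := hg.C
    refine ⟨?_, ?_, ?_⟩ <;> simp only [bB, bD, C₀, hd, Matrix.transpose_zero, Matrix.zero_mul,
      Matrix.mul_zero, sub_zero] <;> linarith
  · filter_upwards [hgood, hD, hcomp, ae_restrict_mem measurableSet_Icc] with t hg hd hco htm P₁ P₂
      hP₁ hP₂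
    obtain ⟨k₁, k₂⟩ := hco P₁ P₂ hP₁ hP₂
    have hRs := transpose_eq_of_coercive hg.R₂_coercive
    set M := S.B₂ t * (S.R₂ t)⁻¹ * (S.B₂ t)ᵀ with hM
    have hMs : Mᵀ = M := by
      rw [hM, Matrix.transpose_mul, Matrix.transpose_mul, Matrix.transpose_transpose,
        Matrix.transpose_nonsing_inv, hRs, Matrix.mul_assoc]
    have hA : S.A₀ t P₂ = S.A t - M * P₂ := by
      simp only [A₀, N₂, hd, Matrix.transpose_zero, Matrix.zero_mul, add_zero,
        Matrix.mul_zero, hM, Matrix.mul_assoc]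
    -- The two terms containing `P₂`, the only unbounded ones, appear with a minus sign, and `hcomp`
    -- makes their traces nonnegative.
    have e : W t * ((S.A₀ t P₂)ᵀ * P₁ + P₁ * S.A₀ t P₂) =
        W t * ((S.A t)ᵀ * P₁ + P₁ * S.A t) - W t * (P₂ * M * P₁) - W t * (P₁ * M * P₂) := by
      rw [hA, Matrix.transpose_sub, Matrix.transpose_mul, hMs, PSD.transpose_eq hP₂]
      noncomm_ring
    have h1 := norm_lyapunov_le (S.A t) 0 P₁ (b := 0) hg.A (by simp)
    rw [mul_zero, mul_zero, add_zero, add_zero] at h1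
    have h2 : (W t * ((S.A t)ᵀ * P₁ + P₁ * S.A t)).trace ≤
        n * (ω * (2 * c * (n * (n * P₁.trace)))) :=
      (trace_mul_le _ _).trans (mul_le_mul_of_nonneg_left
        (mul_le_mul (hWω t htm) (h1.trans (mul_le_mul_of_nonneg_left (PSD.norm_le_trace hP₁)
          (show 0 ≤ 2 * c by positivity))) (norm_nonneg _) hω) hn)
    have h3 := mul_nonneg hc hP₁.trace_nonneg
    rw [e, Matrix.trace_sub, Matrix.trace_sub, ha']
    linarith

lemma trace_fin_one (M : Matrix (Fin 1) (Fin 1) ℝ) : M.trace = M 0 0 := by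
  simp [Matrix.trace]

lemma norm_fin_one (M : Matrix (Fin 1) (Fin 1) ℝ) : ‖M‖ = |M 0 0| := by
  rw [← sq_eq_sq₀ (norm_nonneg _) (abs_nonneg _), norm_sq_eq_sum, sq_abs]
  simp

/-- In the scalar case `P₂ / (R₂ + D₂² P₂) ≤ 1 / D₂²`, which the lower bound on `|D₂|` controls. -/
lemma aprioriEstimate_of_caseNondegenerate {S : LQGame n m₁ m₂} {T : ℝ} (hT : 0 < T)
    (hb : S.BoundedCoefficients T) (hp : S.Positivity T) (h : S.CaseNondegenerate T) :
    S.AprioriEstimate T := by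
  obtain ⟨rfl, rfl, rfl, η, hη, hD⟩ := h
  obtain ⟨c, δ, hc, hδ, hgood⟩ := exists_goodTime hb hp
  refine aprioriEstimate_of_decay hT hδ hc hgood (ν := (η ^ 2)⁻¹) (by positivity) ?_
  filter_upwards [hgood, hD] with t hg hd P hP
  have hd := hd 0 0
  have hP0 : 0 ≤ P 0 0 := hP.diag_nonneg
  have hR0 : 0 < S.R₂ t 0 0 := (posDef_of_coercive hδ hg.R₂_coercive).diag_pos
  have hN : S.N₂ t P 0 0 = (S.R₂ t 0 0 + S.D₂ t 0 0 * P 0 0 * S.D₂ t 0 0)⁻¹ := by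
    simp [N₂, Matrix.inv_subsingleton, Matrix.mul_apply]
  have hDsq : η ^ 2 ≤ S.D₂ t 0 0 ^ 2 := by
    rw [← sq_abs (S.D₂ t 0 0)]
    exact pow_le_pow_left₀ hη.le hd.le 2
  have hpos : 0 < S.R₂ t 0 0 + S.D₂ t 0 0 * P 0 0 * S.D₂ t 0 0 := by
    have : 0 ≤ S.D₂ t 0 0 ^ 2 * P 0 0 := by positivity
    linarith
  rw [norm_fin_one, norm_fin_one, hN, abs_of_nonneg (inv_nonneg.2 hpos.le), abs_of_nonneg hP0,
    inv_mul_le_iff₀ hpos, ← div_eq_mul_inv, le_div_iff₀ (by positivity)]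
  nlinarith [mul_le_mul_of_nonneg_right hDsq hP0]

/-- Scalars commute, so with weight `1` the compatibility terms are products of nonnegative numbers.
-/
lemma aprioriEstimate_of_caseScalar {S : LQGame n m₁ m₂} {T : ℝ} (hT : 0 < T)
    (hb : S.BoundedCoefficients T) (hp : S.Positivity T) (h : S.CaseScalar T) :
    S.AprioriEstimate T := by
  obtain ⟨rfl, rfl, rfl, hD⟩ := h
  obtain ⟨c, δ, hc, hδ, hgood⟩ := exists_goodTime hb hp
  refine aprioriEstimate_of_D₂_eq_zero (W := fun _ => 1) (w := 1) (L := 0)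
    (ω := ‖(1 : Matrix (Fin 1) (Fin 1) ℝ)‖) hT hδ hc hgood hD one_pos le_rfl (norm_nonneg _)
    (fun t _ => by rw [one_smul, sub_self]; exact Matrix.PosSemidef.zero) (fun s _ t _ => by simp)
    (fun _ _ => le_rfl) ?_
  filter_upwards [hgood] with t hg P₁ P₂ hP₁ hP₂
  have hM := PSD.conj (posDef_of_coercive hδ hg.R₂_coercive).inv.posSemidef (S.B₂ t)ᵀ
  rw [Matrix.transpose_transpose] at hM
  set M := S.B₂ t * (S.R₂ t)⁻¹ * (S.B₂ t)ᵀ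
  have h0 : 0 ≤ M 0 0 := hM.diag_nonneg
  have h1 : 0 ≤ P₁ 0 0 := hP₁.diag_nonneg
  have h2 : 0 ≤ P₂ 0 0 := hP₂.diag_nonneg
  rw [one_mul, one_mul, trace_fin_one, trace_fin_one]
  simp only [Matrix.mul_apply, Fin.sum_univ_one]
  constructor <;> positivity

/-- Time is placed in the state slot, over a trivial parameter, so the `UnifLip` calculus also
yields Lipschitz dependence of `B₂ R₂⁻¹ B₂ᵀ` on time. -/
lemma unifLip_of_matrixC1 {k l : ℕ} {T : ℝ} (hT : 0 < T) {M : ℝ → Matrix (Fin k) (Fin l) ℝ}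
    (h : MatrixC1 T M) : UnifLip Set.univ (Set.Icc 0 T) fun (_ : ℝ) (s : ℝ) => M s := by
  have h1 : ∀ i j, ∃ r : ℝ, 0 ≤ r ∧ (∀ s ∈ Set.Icc 0 T, |M s i j| ≤ r) ∧
      ∀ s ∈ Set.Icc 0 T, ∀ t ∈ Set.Icc 0 T, |M s i j - M t i j| ≤ r * |s - t| := by
    intro i j
    obtain ⟨r₁, hr₁⟩ := isCompact_Icc.exists_bound_of_continuousOn (h i j).continuousOn
    obtain ⟨r₂, hr₂⟩ := isCompact_Icc.exists_bound_of_continuousOn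
      ((h i j).continuousOn_derivWithin (uniqueDiffOn_Icc hT) le_rfl)
    refine ⟨max 0 (max r₁ r₂), le_max_left _ _, fun s hs => (hr₁ s hs).trans (by simp),
      fun s hs t ht => ?_⟩
    have := (convex_Icc 0 T).norm_image_sub_le_of_norm_derivWithin_le
      ((h i j).differentiableOn one_ne_zero) hr₂ ht hs
    refine this.trans (mul_le_mul_of_nonneg_right (by simp) (norm_nonneg _))
  choose r hr0 hr1 hr2 using h1
  refine ⟨∑ i, ∑ j, r i j, Finset.sum_nonneg fun i _ => Finset.sum_nonneg fun j _ => hr0 i j,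
    fun _ _ => ⟨fun s hs => (norm_le_sum_abs _).trans
      (Finset.sum_le_sum fun i _ => Finset.sum_le_sum fun j _ => hr1 i j s hs),
      fun s hs t ht => (norm_le_sum_abs _).trans ?_⟩⟩
  rw [Finset.sum_mul]
  refine Finset.sum_le_sum fun i _ => ?_
  rw [Finset.sum_mul]
  exact Finset.sum_le_sum fun j _ => hr2 i j s hs t ht

/-- The weight must be controlled at every time, while coercivity of `R₂` is assumed only almost
everywhere; continuity closes this gap. -/
lemma posSemidef_of_ae {k : ℕ} {T : ℝ} (hT : 0 < T) {M : ℝ → Matrix (Fin k) (Fin k) ℝ}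
    (hc : ∀ i j, ContinuousOn (fun t => M t i j) (Set.Icc 0 T))
    (h : ∀ᵐ t ∂(volume.restrict (Set.Icc 0 T)), (M t).PosSemidef) :
    ∀ t ∈ Set.Icc 0 T, (M t).PosSemidef := by
  intro t ht
  refine psd_iff.2 ⟨?_, fun v => ?_⟩
  · ext i j
    exact Measure.eqOn_Icc_of_ae_eq volume hT.ne (f := fun t => M t j i) (g := fun t => M t i j)
      (h.mono fun s hs => congrFun (congrFun (PSD.transpose_eq hs) i) j) (hc j i) (hc i j) ht
  · have hq : ContinuousOn (fun t => v ⬝ᵥ (M t *ᵥ v)) (Set.Icc 0 T) := by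
      simp only [dotProduct, Matrix.mulVec]
      exact continuousOn_finsetSum _ fun i _ => continuousOn_const.mul
        (continuousOn_finsetSum _ fun j _ => (hc i j).mul continuousOn_const)
    -- Nonnegativity is encoded as the equation `min q 0 = 0`, because equalities almost everywhere
    -- extend by continuity.
    have := Measure.eqOn_Icc_of_ae_eq volume hT.ne (f := fun t => min (v ⬝ᵥ (M t *ᵥ v)) 0)
      (g := fun _ => 0) (h.mono fun s hs => min_eq_right ((psd_iff.1 hs).2 v))
      (hq.inf continuousOn_const) continuousOn_const ht
    exact min_eq_right_iff.1 this

/-- The quadratic form is jointly continuous and positive on the compact product of the interval and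
the unit sphere, hence bounded below there by a positive constant. -/
lemma exists_coercive_of_posDef {k : ℕ} {T : ℝ} {M : ℝ → Matrix (Fin k) (Fin k) ℝ}
    (hc : ∀ i j, ContinuousOn (fun t => M t i j) (Set.Icc 0 T))
    (h : ∀ t ∈ Set.Icc 0 T, (M t).PosDef) :
    ∃ w : ℝ, 0 < w ∧ ∀ t ∈ Set.Icc 0 T, (M t - w • (1 : Matrix (Fin k) (Fin k) ℝ)).PosSemidef := by
  have hcomp : IsCompact (Set.Icc 0 T ×ˢ Metric.sphere (0 : Fin k → ℝ) 1) :=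
    isCompact_Icc.prod (isCompact_sphere 0 1)
  have hq : ContinuousOn (fun p : ℝ × (Fin k → ℝ) => p.2 ⬝ᵥ (M p.1 *ᵥ p.2))
      (Set.Icc 0 T ×ˢ Metric.sphere (0 : Fin k → ℝ) 1) := by
    simp only [dotProduct, Matrix.mulVec]
    refine continuousOn_finsetSum _ fun i _ => ContinuousOn.mul (by fun_prop)
      (continuousOn_finsetSum _ fun j _ => ContinuousOn.mul ?_ (by fun_prop))
    exact (hc i j).comp continuousOn_fst fun p hp => hp.1
  obtain ⟨w, hw, hwle⟩ := hcomp.exists_forall_le' hq (a := 0) fun p hp => by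
    have hne : p.2 ≠ 0 := by
      intro h0
      have := hp.2
      rw [h0] at this
      simp at this
    simpa using (h p.1 hp.1).dotProduct_mulVec_pos hne
  have hk : (0 : ℝ) ≤ k := Nat.cast_nonneg k
  -- The sphere is that of the sup norm, and `v ⬝ᵥ v ≤ k ‖v‖²` accounts for the factor; `k + 1`
  -- avoids dividing by zero when `k = 0`.
  refine ⟨w / (k + 1), by positivity, fun t ht => psd_iff.2 ⟨?_, fun v => ?_⟩⟩
  · rw [Matrix.transpose_sub, PSD.transpose_eq (h t ht).posSemidef, Matrix.transpose_smul,
      Matrix.transpose_one]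
  · have hvv : v ⬝ᵥ v ≤ k * ‖v‖ ^ 2 := by
      calc v ⬝ᵥ v ≤ ∑ _i : Fin k, ‖v‖ ^ 2 := Finset.sum_le_sum fun i _ => by
            have := norm_le_pi_norm v i
            rw [Real.norm_eq_abs] at this
            nlinarith [abs_mul_abs_self (v i), abs_nonneg (v i)]
        _ = _ := by simp
    have hlow : w * ‖v‖ ^ 2 ≤ v ⬝ᵥ (M t *ᵥ v) := by
      rcases eq_or_ne v 0 with rfl | hv
      · simp
      · have hv0 : 0 < ‖v‖ := norm_pos_iff.2 hv
        have hu : ‖(‖v‖⁻¹ • v)‖ = 1 := by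
          rw [norm_smul, norm_inv, norm_norm, inv_mul_cancel₀ hv0.ne']
        have := hwle (t, ‖v‖⁻¹ • v) ⟨ht, by simpa using hu⟩
        simp only [Matrix.mulVec_smul, dotProduct_smul, smul_dotProduct, smul_eq_mul] at this
        rw [← mul_assoc, ← mul_inv, ← div_eq_inv_mul, le_div_iff₀ (by positivity)] at this
        linarith
    simp only [Matrix.sub_mulVec, Matrix.smul_mulVec, Matrix.one_mulVec, dotProduct_sub,
      dotProduct_smul, smul_eq_mul]
    have h1 : w / (k + 1) * (v ⬝ᵥ v) ≤ w / (k + 1) * ((k + 1) * ‖v‖ ^ 2) :=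
      mul_le_mul_of_nonneg_left (by nlinarith [sq_nonneg ‖v‖]) (by positivity)
    have h2 : w / (k + 1) * ((k + 1) * ‖v‖ ^ 2) = w * ‖v‖ ^ 2 := by field_simp
    linarith

/-- The weight is the follower's feedback matrix `W = B₂ R₂⁻¹ B₂ᵀ`. The dangerous terms become `tr
((W P₂ W) P₁)` and its mirror image, which are nonnegative even though the matrices need not
commute. -/
lemma aprioriEstimate_of_caseFullRank {S : LQGame n m₁ m₂} {T : ℝ} (hT : 0 < T)
    (hb : S.BoundedCoefficients T) (hp : S.Positivity T) (h : S.CaseFullRank T) :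
    S.AprioriEstimate T := by
  obtain ⟨hD, hrank, hB, hR⟩ := h
  obtain ⟨c, δ, hc, hδ, hgood⟩ := exists_goodTime hb hp
  have hRco : ∀ t ∈ Set.Icc 0 T,
      (S.R₂ t - δ • (1 : Matrix (Fin m₂) (Fin m₂) ℝ)).PosSemidef :=
    posSemidef_of_ae hT (fun i j => (hR i j).continuousOn.sub continuousOn_const)
      (hgood.mono fun t ht => ht.R₂_coercive)
  set W : ℝ → Matrix (Fin n) (Fin n) ℝ := fun t => S.B₂ t * (S.R₂ t)⁻¹ * (S.B₂ t)ᵀ with hWdef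
  have hWlip : UnifLip Set.univ (Set.Icc 0 T) fun (_ : ℝ) (s : ℝ) => W s :=
    ((unifLip_of_matrixC1 hT hB).mul ((unifLip_of_matrixC1 hT hR).inv hδ fun _ _ t ht => hRco t ht)).mul
      (unifLip_of_matrixC1 hT hB).transpose
  obtain ⟨L, hL, HL⟩ := hWlip
  obtain ⟨HLb, HLl⟩ := HL 0 (Set.mem_univ _)
  have hWc : ∀ i j, ContinuousOn (fun t => W t i j) (Set.Icc 0 T) := by
    refine fun i j =>
      (LipschitzOnWith.of_dist_le_mul (K := L.toNNReal) fun s hs t ht => ?_).continuousOn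
    rw [Real.dist_eq, Real.dist_eq, Real.coe_toNNReal _ hL]
    exact (abs_entry_le_norm (W s - W t) i j).trans (HLl s hs t ht)
  have hWpd : ∀ t ∈ Set.Icc 0 T, (W t).PosDef := by
    intro t ht
    -- Full row rank makes `v ↦ v B₂` injective, so congruence by `B₂` preserves definiteness of
    -- `R₂⁻¹`.
    have hli : LinearIndependent ℝ (S.B₂ t).row := by
      rw [linearIndependent_iff_card_eq_finrank_span, Fintype.card_fin, Set.finrank,
        ← Matrix.rank_eq_finrank_span_row, hrank t ht]
    have := (posDef_of_coercive hδ (hRco t ht)).inv.mul_mul_conjTranspose_same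
      (B := S.B₂ t) (Matrix.vecMul_injective_iff.2 hli)
    rwa [Matrix.conjTranspose_eq_transpose_of_trivial] at this
  obtain ⟨w, hw, hWw⟩ := exists_coercive_of_posDef hWc hWpd
  refine aprioriEstimate_of_D₂_eq_zero (W := W) hT hδ hc hgood hD hw hL hL hWw HLl HLb ?_
  filter_upwards [ae_restrict_mem measurableSet_Icc] with t ht P₁ P₂ hP₁ hP₂
  have hWs := PSD.transpose_eq (hWpd t ht).posSemidef
  have key : ∀ {X Y : Matrix (Fin n) (Fin n) ℝ}, X.PosSemidef → Y.PosSemidef →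
      0 ≤ (W t * (X * W t * Y)).trace := by
    intro X Y hX hY
    have h1 := PSD.trace_mul_nonneg (PSD.conj hX (W t)) hY
    rwa [hWs, Matrix.mul_assoc, Matrix.mul_assoc, ← Matrix.mul_assoc X] at h1
  exact ⟨key hP₂ hP₁, key hP₁ hP₂⟩

end Cases

end LQGame

theorem theorem4 {n m₁ m₂ : ℕ} (S : LQGame n m₁ m₂) (T : ℝ) (hT : 0 < T)
    (hbdd : S.BoundedCoefficients T) (hpos : S.Positivity T)
    (hcase : S.CaseNondegenerate T ∨ S.CaseScalar T ∨ S.CaseFullRank T) :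
    S.AprioriEstimate T ∧ S.GloballyWellPosed T := by
  have ha : S.AprioriEstimate T := by
    rcases hcase with h | h | h
    · exact LQGame.aprioriEstimate_of_caseNondegenerate hT hbdd hpos h
    · exact LQGame.aprioriEstimate_of_caseScalar hT hbdd hpos h
    · exact LQGame.aprioriEstimate_of_caseFullRank hT hbdd hpos h
  exact ⟨ha, LQGame.globallyWellPosed_of_aprioriEstimate hT hbdd hpos ha⟩
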